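/- **Threads.** Let basic actions be pairs $f.m$ of a focus $f$ and a method $m$, and let $\mathsf{tau}\neq\mathsf{gnl}$ be internal actions. A thread is a possibly infinite tree: it is $\mathsf S$ (termination), $\mathsf D$ (inaction), $x\unlhd a\unrhd y$ (perform basic action $a$; continue as $x$ on reply true and as $y$ on reply false) or $\iota\circ x$ (perform the internal action $\iota$, then continue as $x$); guarded recursive specifications have unique solutions, as in the projective limit model of basic thread algebra. The abstraction operator $\tau_\iota$ removes all performances of the internal action $\iota$, with $\tau_\iota(\iota\circ\iota\circ\cdots)=\mathsf D$. The thread $x/_f H$ is $x$ using the service $H$ for focus $f$: each action $f.m$ is processed by $H$ and becomes $\mathsf{tau}$, followed by the continuation chosen by the reply of $H$; if $H$ blocks, the result is $\mathsf D$; all other actions are unchanged. **Programs.** A PGA program is a closed term over primitive instructions (plain basic instructions $a$, tests $+a$, $-a$, forward jumps $\#l$, termination $!$) built with concatenation and repetition $x^\omega$. It denotes a nonempty finite or eventually periodic sequence of instructions. $|x|$ is the thread it produces: $+a$ ($-a$) skips one instruction on reply false (true), a plain basic instruction never skips, and $\#0$, infinite chains of jumps and leaving the sequence give $\mathsf D$.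 A PGLD program is a finite sequence $u_1;\dots;u_k$ of plain basic instructions, tests and absolute jumps $\#\#l$, and $$\mathrm{pgld2pga}(u_1;\dots;u_k)=(\psi_1(u_1);\dots;\psi_k(u_k);!;!)^\omega,$$ where $\psi_j(\#\#l)$ is $\#(l-j)$ if $j\le l\le k$, $\#(k+2-(j-l))$ if $0<l<j$, and $!$ if $l=0$ or $l>k$, and $\psi_j$ leaves the other instructions unchanged. Fix a focus $\mathsf{irf}$ and a set of core basic instructions, which are basic actions with foci other than $\mathsf{irf}$. The core primitive instructions are the primitive instructions of PGA over these. A PGA+ program may in addition contain, for $i\in\mathbb N$ and core primitive instructions $u$, the plain instructions $\mathrm{swo}_i$ (switch-over), $\mathrm{put}_{i,u}$ and $\mathrm{get}_i$, but not in tests. Let $\alpha$ be a vector of length $k$ of polyadic instruction sequences, each given in a program notation (such as PGLA+, …, PGLS+) that has a projection to PGA+ programs; $\alpha_i$ is the projection of the $i$-th one. An instruction register file state is a finite partial function $\sigma$ from $\mathbb N$ to core primitive instructions. $p[\sigma]$ is $p$ with $\mathrm{get}_i$ replaced by $\sigma(i)$ for all $i\in\mathrm{dom}(\sigma)$. The polyadic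 thread extraction $|P|_\sigma(\alpha)$ is defined as thread extraction for PGA, except that: $\mathrm{put}_{i,u}$ performs $\mathsf{tau}$ and continues with $\sigma$ updated to have $u$ in register $i$; $\mathrm{get}_i$ gives $\mathsf D$; $\mathrm{swo}_i$ gives $\mathsf S$ if $i=0$ or $i>k$, and otherwise gives $\mathsf{gnl}\circ|\alpha_i[\sigma]|_\sigma(\alpha)$ if no get instruction occurs in $\alpha_i[\sigma]$, and $\mathsf D$ if one does. **Register file service.** Let $n\in\mathbb N$ and let $\mathit{Instr}$ be a finite set of core primitive instructions such that $1\le i\le n$ and $u\in\mathit{Instr}$ whenever $\mathrm{put}_{i,u}$ occurs in $P$ or $\alpha$. (If no put instruction has register number $0$, one may take for $n$ the highest number in the put and get instructions that occur, and for $\mathit{Instr}$ the set of all $u$ that occur in put instructions.) Let $\mathit{Reg}=[1,n]$, let $\mathit{IRFS}$ be the set of all partial functions from $\mathit{Reg}$ to $\mathit{Instr}$, let $n'$ be its cardinality and let $\theta:\mathit{IRFS}\to[1,n']$ be any bijection. For $\sigma\in\mathit{IRFS}$, $\mathrm{IRF}_\sigma$ is the service with initial state $\sigma$ that accepts exactly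 the (pairwise distinct) methods $\mathrm{put}{:}i{:}u$ ($i\in\mathit{Reg}$, $u\in\mathit{Instr}$), which put $u$ into register $i$ and reply true, and $\mathrm{eq}{:}j$ ($1\le j\le n'$), which reply whether $\theta$ of the current state is $j$; it blocks all other methods, and once it has blocked it keeps blocking. **Synthesis.** PGLC programs are finite sequences of plain basic instructions, tests, forward jumps $\#l$, backward jumps $\backslash\#l$ and $!$. The embedding $\mathrm{pga2pglc}$ takes a PGA program in the form $u_1;\dots;u_p$ or $u_1;\dots;u_p;(u_{p+1};\dots;u_{p+q})^\omega$ to $u'_1;\dots;u'_p;\#0;\#0$ or $u'_1;\dots;u'_{p+q};\backslash\#q;\backslash\#q$, respectively. Here $u'_j=u_j$, except that a jump past the end becomes $\#0$ in the first form, and in the second form becomes the relative jump to the corresponding position in the first copy of the repeated part. The embedding $\mathrm{pglc2pgld}$ replaces relative jumps by the corresponding absolute jumps, and $!$ and jumps out of the program by $\#\#0$. Let $G_{i,j}=\mathrm{pga2pglc}(\alpha_i[\theta^{-1}(j)])$ if no get instruction occurs in $\alpha_i[\theta^{-1}(j)]$, and $G_{i,j}=\mathrm{pga2pglc}(\#0)$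 otherwise. Form $$v_1;\dots;v_r=\mathrm{pglc2pgld}\bigl(\mathrm{pga2pglc}(P);G_{1,1};\dots;G_{1,n'};\dots;G_{k,1};\dots;G_{k,n'}\bigr).$$ Then $\mathrm{pgap2pgld}(P)(\alpha)$ is the PGLD program obtained from $v_1;\dots;v_r$ by replacing, at each position $j$, $\mathrm{swo}_i$ by $\#\#l_i$ if $1\le i\le k$ and by $\#\#0$ otherwise, $\mathrm{put}_{i,u}$ by $\mathsf{irf}.\mathrm{put}{:}i{:}u$, and $\mathrm{get}_i$ by $\#\#j$, and then appending, for $i=1,\dots,k$ in order, $$+\mathsf{irf}.\mathrm{eq}{:}1;\#\#l_{i,1};\dots;+\mathsf{irf}.\mathrm{eq}{:}n';\#\#l_{i,n'}.$$ Here $l_i=\mathrm{len}(\mathrm{pga2pglc}(P))+\sum_{h\in[1,k],\,h'\in[1,n']}\mathrm{len}(G_{h,h'})+2n'(i-1)+1$ and $l_{i,j}=\mathrm{len}(\mathrm{pga2pglc}(P))+\sum_{h\in[1,i-1],\,h'\in[1,n']}\mathrm{len}(G_{h,h'})+\sum_{h'\in[1,j-1]}\mathrm{len}(G_{i,h'})+1$.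 **Theorem 1.** For every PGA+ program $P$, every polyadic instruction sequence vector $\alpha$, all $n$, $\mathit{Instr}$ and $\theta$ as above, and every $\sigma\in\mathit{IRFS}$, $$\tau_{\mathsf{tau}}\bigl(|\mathrm{pgld2pga}(\mathrm{pgap2pgld}(P)(\alpha))|\,/_{\mathsf{irf}}\,\mathrm{IRF}_\sigma\bigr)=\tau_{\mathsf{tau}}\bigl(\tau_{\mathsf{gnl}}(|P|_\sigma(\alpha))\bigr).$$ -/

import Mathlib

noncomputable section

namespace PolyInSeq

/-! ### Threads

Threads over basic actions `B` and internal actions `I`: the possibly infinite trees whose nodes are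
termination, inaction, a basic action with two continuations (one for each reply) or an internal
action with one continuation (the reply to an internal action is always true, so that
`x ⊴ ι ⊵ y = ι ∘ x`).  As the final coalgebra of this shape, it is the projective limit of the finite
threads, and guarded recursive specifications have unique solutions in it. -/

/-- The node labels of threads. -/
inductive Head (B I : Type) : Type
  | exit
  | dead
  | act (a : B)
  | int (i : I)

/-- The index type of the continuations below a node. -/
def Head.Arity {B I : Type} : Head B I → Type
  | .exit => Empty
  | .dead => Empty
  | .act _ => Bool
  | .int _ => Unit

/-- The polynomial functor of thread nodes. -/
def threadF (B I : Type) : PFunctor.{0, 0} := ⟨Head B I, Head.Arity⟩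

/-- The type of threads. -/
def Thread (B I : Type) : Type := (threadF B I).M

/-- One node together with its continuations in `X`: `exit` is termination, `dead` is inaction,
`act a k` performs the basic action `a` and continues as `k r` upon reply `r`, and `int i x`
performs the internal action `i` and continues as `x`. -/
inductive View (B I X : Type) : Type
  | exit
  | dead
  | act (a : B) (k : Bool → X)
  | int (i : I) (x : X)

/-- A node as an element of the polynomial functor. -/
def View.toObj {B I X : Type} : View B I X → threadF B I X
  | .exit => ⟨Head.exit, Empty.elim⟩
  | .dead => ⟨Head.dead, Empty.elim⟩
  | .act a k => ⟨Head.act a, k⟩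
  | .int i x => ⟨Head.int i, fun _ => x⟩

/-- An element of the polynomial functor as a node. -/
def View.ofObj {B I X : Type} : threadF B I X → View B I X
  | ⟨Head.exit, _⟩ => .exit
  | ⟨Head.dead, _⟩ => .dead
  | ⟨Head.act a, k⟩ => .act a k
  | ⟨Head.int i, k⟩ => .int i (k ())

/-- The root of a thread together with the threads below it. -/
def Thread.view {B I : Type} (x : Thread B I) : View B I (Thread B I) :=
  View.ofObj (PFunctor.M.dest x)

/-- The thread of a state of a transition system: the unique solution of the guarded recursive
specification with one equation for each state. -/
def Thread.unfold {B I X : Type} (step : X → View B I X) (s : X) : Thread B I :=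
  PFunctor.M.corec (fun s => (step s).toObj) s

/-! ### Abstraction -/

/-- `Settles ι x y`: `x` performs the internal action `ι` finitely many times, then proceeds as `y`,
and `y` does not start with `ι`. -/
inductive Settles {B I : Type} (ι : I) : Thread B I → Thread B I → Prop
  | here (x : Thread B I) (h : ∀ y, x.view ≠ .int ι y) : Settles ι x x
  | hop (x y z : Thread B I) (h : x.view = .int ι y) (h' : Settles ι y z) : Settles ι x z

open Classical in
/-- One step of the abstraction of a thread: internal actions `ι` are skipped, and a thread that
performs `ι` forever becomes inactive. -/
def abstrStep {B I : Type} (ι : I) (x : Thread B I) : View B I (Thread B I) :=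
  if h : ∃ y, Settles ι x y then h.choose.view else .dead

/-- The abstraction operator that conceals the internal action `ι`. -/
def abstr {B I : Type} (ι : I) (x : Thread B I) : Thread B I :=
  Thread.unfold (abstrStep ι) x

/-! ### Services and the use operator -/

/-- The replies of services. -/
inductive Reply : Type
  | yes
  | no
  | blocked

/-- A service that accepts methods from `M`. -/
structure Service (M : Type) where
  /-- the set of states -/
  State : Type
  /-- the effect function -/
  eff : M → State → State
  /-- the yield function -/
  yld : M → State → Reply
  /-- the initial state -/
  init : State
  blocked_of_blocked : ∀ m s, yld m s = .blocked → ∀ m', yld m' (eff m s) = .blocked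

open Classical in
/-- One step of a thread `p.1` that uses, for focus `f`, the service `H` in state `p.2`.  The basic
action `f.m` is the pair `(f, m)`. -/
def useStep {F M I : Type} (tau : I) (f : F) (H : Service M) (p : Thread (F × M) I × H.State) :
    View (F × M) I (Thread (F × M) I × H.State) :=
  match p.1.view with
  | .exit => .exit
  | .dead => .dead
  | .int i x => .int i (x, p.2)
  | .act a k =>
    if a.1 = f then
      match H.yld a.2 p.2 with
      | .yes => .int tau (k true, H.eff a.2 p.2)
      | .no => .int tau (k false, H.eff a.2 p.2)
      | .blocked => .dead
    else .act a (fun r => (k r, p.2))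

/-- The use operator `x /_f H`. -/
def use {F M I : Type} (tau : I) (x : Thread (F × M) I) (f : F) (H : Service M) :
    Thread (F × M) I :=
  Thread.unfold (useStep tau f H) (x, H.init)

/-! ### Program algebra -/

/-- The primitive instructions of PGA with plain basic instructions from `B` and test instructions
for the basic instructions from `T`. -/
inductive PInstr (B T : Type) : Type
  | plain (b : B)
  | pos (t : T)
  | neg (t : T)
  | jmp (l : ℕ)
  | halt

/-- Closed terms of program algebra over the instructions `U`. -/
inductive Term (U : Type) : Type
  | instr (u : U)
  | conc (x y : Term U)
  | rep (x : Term U)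

/-- The canonical form of a closed term: a pair `(p, q)` that stands for the finite sequence `p` if
`q = []`, and for `p` followed by infinitely many copies of `q` otherwise. -/
def Term.canon {U : Type} : Term U → List U × List U
  | .instr u => ([u], [])
  | .conc x y => if x.canon.2 = [] then (x.canon.1 ++ y.canon.1, y.canon.2) else x.canon
  | .rep x => if x.canon.2 = [] then ([], x.canon.1) else x.canon

/-- The instruction sequence denoted by a closed term: the instruction at position `i`, counted from
`0`, if there is one. -/
def Term.at {U : Type} (x : Term U) (i : ℕ) : Option U :=
  if i < x.canon.1.length then x.canon.1[i]?
  else x.canon.2[(i - x.canon.1.length) % x.canon.2.length]?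

/-- The instruction `u` occurs in the instruction sequence denoted by `x`. -/
def Term.Occurs {U : Type} (u : U) (x : Term U) : Prop := ∃ i, x.at i = some u

/-- Replacement of all instructions in a term. -/
def Term.map {U V : Type} (f : U → V) : Term U → Term V
  | .instr u => .instr (f u)
  | .conc x y => .conc (x.map f) (y.map f)
  | .rep x => .rep (x.map f)

/-- The repetition-free term `u₁ ; … ; uₖ ; v`. -/
def Term.ofList {U : Type} (us : List U) (v : U) : Term U :=
  us.foldr (fun u x => .conc (.instr u) x) (.instr v)

/-- `Lands s i u j`: when execution of the sequence `s` is at position `i`, then, after following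
finitely many forward jumps, execution is at position `j`, where the instruction is `u`, which is not
a jump.  It holds for no `u` and `j` if the chain of jumps is infinite, contains a jump over distance
`0`, or leaves the sequence. -/
inductive Lands {B T : Type} (s : ℕ → Option (PInstr B T)) : ℕ → PInstr B T → ℕ → Prop
  | here (i : ℕ) (u : PInstr B T) (h : s i = some u) (hu : ∀ l, u ≠ .jmp l) : Lands s i u i
  | hop (i l j : ℕ) (u : PInstr B T) (h : s i = some (.jmp l)) (hl : l ≠ 0)
      (h' : Lands s (i + l) u j) : Lands s i u j

open Classical in
/-- The first instruction other than a jump that is reached from position `i`, with its position. -/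
def landing {B T : Type} (s : ℕ → Option (PInstr B T)) (i : ℕ) : Option (PInstr B T × ℕ) :=
  if h : ∃ p : PInstr B T × ℕ, Lands s i p.1 p.2 then some h.choose else none

/-- One step of the execution of a PGA program from position `i`. -/
def extrStep {B I : Type} (x : Term (PInstr B B)) (i : ℕ) : View B I ℕ :=
  match landing x.at i with
  | none => .dead
  | some (.plain a, j) => .act a (fun _ => j + 1)
  | some (.pos a, j) => .act a (fun r => if r then j + 1 else j + 2)
  | some (.neg a, j) => .act a (fun r => if r then j + 2 else j + 1)
  | some (.jmp _, _) => .dead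
  | some (.halt, _) => .exit

/-- Thread extraction of PGA. -/
def extr {B : Type} (I : Type) (x : Term (PInstr B B)) : Thread B I :=
  Thread.unfold (extrStep x) 0

/-! ### The program notations PGLC and PGLD -/

/-- The primitive instructions of PGLD; `ajmp l` is the absolute jump to position `l`, counted from
`1`, and terminates if there is no position `l`. -/
inductive DInstr (B T : Type) : Type
  | plain (b : B)
  | pos (t : T)
  | neg (t : T)
  | ajmp (l : ℕ)

/-- The translation into PGA of the instruction at position `j` of a PGLD program of length `k`. -/
def DInstr.toPGA {B T : Type} (k j : ℕ) : DInstr B T → PInstr B T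
  | .plain b => .plain b
  | .pos t => .pos t
  | .neg t => .neg t
  | .ajmp l =>
    if l = 0 ∨ k < l then .halt else if j ≤ l then .jmp (l - j) else .jmp (k + 2 - (j - l))

/-- The projection of PGLD programs to PGA programs. -/
def pgld2pga {B T : Type} (us : List (DInstr B T)) : Term (PInstr B T) :=
  .rep (.ofList (us.mapIdx (fun j u => u.toPGA us.length (j + 1)) ++ [.halt]) .halt)

/-- The primitive instructions of PGLC, with relative jumps forward and backward.  The termination
instruction is kept, so that programs can be concatenated without disturbing termination. -/
inductive CInstr (B T : Type) : Type
  | plain (b : B)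
  | pos (t : T)
  | neg (t : T)
  | fjmp (l : ℕ)
  | bjmp (l : ℕ)
  | halt

/-- The relative jump from position `j` to position `t`. -/
def CInstr.goto {B T : Type} (j t : ℕ) : CInstr B T :=
  if j ≤ t then .fjmp (t - j) else .bjmp (j - t)

/-- The translation into PGLC of the instruction at position `j` of the program that consists of `p`
instructions followed by the repetition of `q` instructions (`q = 0`: no repetition).  A jump past
the end of the first copy of the repeated part becomes a jump to the corresponding position in that
copy; a jump past the end of a finite program becomes an inactive jump. -/
def PInstr.toPGLC {B T : Type} (p q j : ℕ) : PInstr B T → CInstr B T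
  | .plain b => .plain b
  | .pos t => .pos t
  | .neg t => .neg t
  | .jmp l =>
    if j + l ≤ p + q then .fjmp l
    else if q = 0 then .fjmp 0
    else CInstr.goto j (p + 1 + (j + l - (p + 1)) % q)
  | .halt => .halt

/-- The embedding of PGA programs into PGLC programs. -/
def pga2pglc {B T : Type} (x : Term (PInstr B T)) : List (CInstr B T) :=
  let p := x.canon.1
  let q := x.canon.2
  (p ++ q).mapIdx (fun j u => u.toPGLC p.length q.length (j + 1)) ++
    (if q = [] then [.fjmp 0, .fjmp 0] else [.bjmp q.length, .bjmp q.length])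

/-- The translation into PGLD of the instruction at position `j` of a PGLC program of length `k`;
jumps out of the program terminate. -/
def CInstr.toPGLD {B T : Type} (k j : ℕ) : CInstr B T → DInstr B T
  | .plain b => .plain b
  | .pos t => .pos t
  | .neg t => .neg t
  | .fjmp l => if j + l ≤ k then .ajmp (j + l) else .ajmp 0
  | .bjmp l => if l < j then .ajmp (j - l) else .ajmp 0
  | .halt => .ajmp 0

/-- The embedding of PGLC programs into PGLD programs. -/
def pglc2pgld {B T : Type} (us : List (CInstr B T)) : List (DInstr B T) :=
  us.mapIdx (fun j u => u.toPGLD us.length (j + 1))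

/-! ### Polyadic instruction sequences -/

/-- The core primitive instructions over the core basic instructions `A`. -/
abbrev CPInstr (A : Type) : Type := PInstr A A

/-- The supplementary basic instructions. -/
inductive SBInstr (A : Type) : Type
  | swo (i : ℕ)
  | put (i : ℕ) (u : CPInstr A)
  | get (i : ℕ)

/-- The primitive instructions of PGA+; supplementary basic instructions do not occur in tests. -/
abbrev PInstrP (A : Type) : Type := PInstr (A ⊕ SBInstr A) A

/-- The switch-over instruction. -/
abbrev iSwo {A : Type} (i : ℕ) : PInstrP A := .plain (.inr (.swo i))

/-- The put instruction. -/
abbrev iPut {A : Type} (i : ℕ) (u : CPInstr A) : PInstrP A := .plain (.inr (.put i u))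

/-- The get instruction. -/
abbrev iGet {A : Type} (i : ℕ) : PInstrP A := .plain (.inr (.get i))

/-- Core primitive instructions as primitive instructions of PGA+. -/
def PInstr.core {A : Type} : CPInstr A → PInstrP A
  | .plain a => .plain (.inl a)
  | .pos a => .pos a
  | .neg a => .neg a
  | .jmp l => .jmp l
  | .halt => .halt

/-- PGA+ programs. -/
abbrev PGAp (A : Type) : Type := Term (PInstrP A)

/-- The program notation indices. -/
inductive NotIndex : Type
  | A | B | C | D | Dg | E | S

/-- A program notation for polyadic instruction sequences over the core basic instructions `A`: its
programs, and its projection to PGA+ programs. -/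
structure ProgLang (A : Type) where
  /-- the programs of the notation -/
  Prog : Type
  /-- the projection -/
  prj : Prog → PGAp A

/-- PGLD+ as a program notation; any other notation is given in the same way. -/
def ProgLang.pgldPlus (A : Type) : ProgLang A where
  Prog := {us : List (DInstr (A ⊕ SBInstr A) A) // us ≠ []}
  prj us := pgld2pga us.1

/-- Polyadic instruction sequence vectors: sequences of program notation indices paired with a
program from the notation concerned. -/
abbrev PVector {A : Type} (N : NotIndex → ProgLang A) : Type := List (Σ c : NotIndex, (N c).Prog)

/-- The projection to PGA+ of the `i`-th polyadic instruction sequence in a vector, counted from `1`;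
there is none if `i = 0` or `i` exceeds the length of the vector. -/
def PVector.prj? {A : Type} {N : NotIndex → ProgLang A} (α : PVector N) (i : ℕ) :
    Option (PGAp A) :=
  if i = 0 then none else α[i - 1]?.map (fun e => (N e.1).prj e.2)

/-- Instruction register file states, as partial functions from register numbers to core primitive
instructions. -/
abbrev IRFState (A : Type) : Type := ℕ → Option (CPInstr A)

/-- The effect of putting instruction `u` into register `i`. -/
def IRFState.put {A : Type} (σ : IRFState A) (i : ℕ) (u : CPInstr A) : IRFState A :=
  fun j => if j = i then some u else σ j

/-- Replacement of a get instruction by the contents of the register concerned, if any. -/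
def PInstr.fill {A : Type} (σ : IRFState A) : PInstrP A → PInstrP A
  | .plain (.inr (.get i)) =>
    match σ i with
    | some u => u.core
    | none => iGet i
  | u => u

/-- The program `p[σ]`. -/
def Term.fill {A : Type} (σ : IRFState A) (p : PGAp A) : PGAp A := p.map (PInstr.fill σ)

/-- No get instructions occur in a program. -/
def NoGet {A : Type} (p : PGAp A) : Prop := ∀ i, ¬ p.Occurs (iGet i)

/-- The configurations of the execution of polyadic instruction sequences: the program being
executed, the position in it, and the instruction register file state. -/
structure Config (A : Type) where
  /-- the program being executed -/
  prog : PGAp A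
  /-- the current position, counted from `0` -/
  pos : ℕ
  /-- the instruction register file state -/
  regs : IRFState A

open Classical in
/-- The switch-over to the `i`-th polyadic instruction sequence in a vector. -/
def swoView {A B I : Type} (gnl : I) {N : NotIndex → ProgLang A} (α : PVector N) (i : ℕ)
    (σ : IRFState A) : View B I (Config A) :=
  match α.prj? i with
  | none => .exit
  | some p => if NoGet (p.fill σ) then .int gnl ⟨p.fill σ, 0, σ⟩ else .dead

/-- One step of the execution of polyadic instruction sequences; `act` gives the basic actions of
the core basic instructions. -/
def extrpStep {A B I : Type} (tau gnl : I) (act : A → B) {N : NotIndex → ProgLang A}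
    (α : PVector N) (c : Config A) : View B I (Config A) :=
  match landing c.prog.at c.pos with
  | none => .dead
  | some (.plain (.inl a), j) => .act (act a) (fun _ => ⟨c.prog, j + 1, c.regs⟩)
  | some (.pos a, j) => .act (act a) (fun r => ⟨c.prog, if r then j + 1 else j + 2, c.regs⟩)
  | some (.neg a, j) => .act (act a) (fun r => ⟨c.prog, if r then j + 2 else j + 1, c.regs⟩)
  | some (.jmp _, _) => .dead
  | some (.halt, _) => .exit
  | some (.plain (.inr (.swo i)), _) => swoView gnl α i c.regs
  | some (.plain (.inr (.put i u)), j) => .int tau ⟨c.prog, j + 1, c.regs.put i u⟩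
  | some (.plain (.inr (.get _)), _) => .dead

/-- Thread extraction of PGA+, for an instruction register file state and a vector. -/
def extrp {A B I : Type} (tau gnl : I) (act : A → B) {N : NotIndex → ProgLang A}
    (σ : IRFState A) (α : PVector N) (x : PGAp A) : Thread B I :=
  Thread.unfold (extrpStep tau gnl act α) ⟨x, 0, σ⟩

/-! ### Instruction register file services -/

/-- The set of the states of an instruction register file with registers `1, …, n` that can contain
the instructions from `Instr`. -/
def IRFS {A : Type} (n : ℕ) (Instr : Finset (CPInstr A)) : Set (IRFState A) :=
  {σ | ∀ i u, σ i = some u → (1 ≤ i ∧ i ≤ n) ∧ u ∈ Instr}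

theorem IRFS.put_mem {A : Type} {n : ℕ} {Instr : Finset (CPInstr A)} {σ : IRFState A}
    (hσ : σ ∈ IRFS n Instr) {i : ℕ} {u : CPInstr A} (hi : 1 ≤ i ∧ i ≤ n) (hu : u ∈ Instr) :
    σ.put i u ∈ IRFS n Instr := by
  intro j v h
  unfold IRFState.put at h
  split at h
  · next e =>
    subst e
    cases h
    exact ⟨hi, hu⟩
  · exact hσ j v h

/-- The register put methods and the register file test methods. -/
inductive IRFMeth (A : Type) : Type
  | put (i : ℕ) (u : CPInstr A)
  | eqr (j : ℕ)

/-- The methods that are accepted by instruction register file services with `K` states. -/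
def methIRF {A : Type} (n : ℕ) (Instr : Finset (CPInstr A)) (K : ℕ) : Set (IRFMeth A) :=
  {μ | match μ with
    | .put i u => (1 ≤ i ∧ i ≤ n) ∧ u ∈ Instr
    | .eqr j => 1 ≤ j ∧ j ≤ K}

section

/- In this section, `meth` gives the names in the set `M` of methods of the methods of instruction
register file services, and `θ` numbers the states by `1, …, K`: the number of `σ` is `θ σ + 1`. -/

variable {A M : Type} {n : ℕ} {Instr : Finset (CPInstr A)} {K : ℕ}

open Classical in
/-- The method of instruction register file services that is named by `m`, if any. -/
def decode (n : ℕ) (Instr : Finset (CPInstr A)) (K : ℕ) (meth : IRFMeth A → M) (m : M) :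
    Option (methIRF n Instr K) :=
  if h : ∃ μ : methIRF n Instr K, meth μ = m then some h.choose else none

/-- The effect on the states of the methods that are accepted. -/
def methEff (σ : IRFS n Instr) : methIRF n Instr K → IRFS n Instr
  | ⟨.put i u, h⟩ => ⟨σ.1.put i u, IRFS.put_mem σ.2 h.1 h.2⟩
  | ⟨.eqr _, _⟩ => σ

/-- The replies to the methods that are accepted. -/
def methYld (θ : IRFS n Instr ≃ Fin K) (σ : IRFS n Instr) : methIRF n Instr K → Reply
  | ⟨.put _ _, _⟩ => .yes
  | ⟨.eqr j, _⟩ => if (θ σ : ℕ) + 1 = j then .yes else .no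

/-- The effect function; the undefined state is `none`. -/
def irfEff (meth : IRFMeth A → M) (m : M) (s : Option (IRFS n Instr)) (K : ℕ) :
    Option (IRFS n Instr) :=
  match s, decode n Instr K meth m with
  | some σ, some μ => some (methEff σ μ)
  | _, _ => none

/-- The yield function. -/
def irfYld (θ : IRFS n Instr ≃ Fin K) (meth : IRFMeth A → M) (m : M)
    (s : Option (IRFS n Instr)) : Reply :=
  match s, decode n Instr K meth m with
  | some σ, some μ => methYld θ σ μ
  | _, _ => .blocked

/-- The instruction register file service with initial state `s`. -/
def irfService (θ : IRFS n Instr ≃ Fin K) (meth : IRFMeth A → M) (s : Option (IRFS n Instr)) :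
    Service M where
  State := Option (IRFS n Instr)
  eff m s := irfEff meth m s K
  yld m s := irfYld θ meth m s
  init := s
  blocked_of_blocked := by
    intro m s h m'
    have h0 : irfEff (n := n) (Instr := Instr) meth m s K = none := by
      unfold irfYld at h
      unfold irfEff
      cases s with
      | none => rfl
      | some σ =>
        cases hd : decode n Instr K meth m with
        | none => rfl
        | some μ =>
          rw [hd] at h
          obtain ⟨μ, hμ⟩ := μ
          cases μ with
          | put i u => simp [methYld] at h
          | eqr j => simp only [methYld] at h; split at h <;> cases h
    simp only [h0]
    rfl

/-! ### Program synthesis -/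

open Classical in
/-- The instance of the `i`-th polyadic instruction sequence in a vector for state `σ`. -/
def generate {N : NotIndex → ProgLang A} (α : PVector N) (i : ℕ) (σ : IRFState A) : PGAp A :=
  match α.prj? i with
  | none => .instr .halt
  | some p => if NoGet (p.fill σ) then p.fill σ else .instr (.jmp 0)

/-- The instance of the `i`-th polyadic instruction sequence for the state with number `j + 1`, as a
PGLC program. -/
def block (θ : IRFS n Instr ≃ Fin K) {N : NotIndex → ProgLang A} (α : PVector N) (i : ℕ)
    (j : Fin K) : List (CInstr (A ⊕ SBInstr A) A) :=
  pga2pglc (generate α i (θ.symm j).1)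

/-- The given program followed by all instances of the polyadic instruction sequences in the vector,
as a PGLC program. -/
def expand (θ : IRFS n Instr ≃ Fin K) {N : NotIndex → ProgLang A} (x : PGAp A) (α : PVector N) :
    List (CInstr (A ⊕ SBInstr A) A) :=
  pga2pglc x ++
    (List.range' 1 α.length).flatMap (fun i => (List.finRange K).flatMap (fun j => block θ α i j))

/-- The position at which the search for the right instance of the `i`-th polyadic instruction
sequence starts. -/
def searchPos (θ : IRFS n Instr ≃ Fin K) {N : NotIndex → ProgLang A} (x : PGAp A) (α : PVector N)
    (i : ℕ) : ℕ :=
  (pga2pglc x).length + ∑ h ∈ Finset.Icc 1 α.length, ∑ j : Fin K, (block θ α h j).length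
    + 2 * K * (i - 1) + 1

/-- The position at which the instance of the `i`-th polyadic instruction sequence for the state with
number `j + 1` starts. -/
def blockPos (θ : IRFS n Instr ≃ Fin K) {N : NotIndex → ProgLang A} (x : PGAp A) (α : PVector N)
    (i : ℕ) (j : Fin K) : ℕ :=
  (pga2pglc x).length + ∑ h ∈ Finset.Icc 1 (i - 1), ∑ j' : Fin K, (block θ α h j').length
    + ∑ j' ∈ Finset.univ.filter (fun j' : Fin K => j' < j), (block θ α i j').length + 1

variable {F : Type}

/-- The replacement of the instruction at position `j` of a PGLD program with supplementary basic
instructions; `k` is the length of the vector, `pos i` is the position of the search for the `i`-th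
polyadic instruction sequence, and the basic action `irf.m` is the pair `(irf, m)`. -/
def DInstr.translate (act : A → F × M) (irf : F) (meth : IRFMeth A → M) (k : ℕ) (pos : ℕ → ℕ)
    (j : ℕ) : DInstr (A ⊕ SBInstr A) A → DInstr (F × M) (F × M)
  | .plain (.inl a) => .plain (act a)
  | .plain (.inr (.swo i)) => if 1 ≤ i ∧ i ≤ k then .ajmp (pos i) else .ajmp 0
  | .plain (.inr (.put i u)) => .plain (irf, meth (.put i u))
  | .plain (.inr (.get _)) => .ajmp j
  | .pos a => .pos (act a)
  | .neg a => .neg (act a)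
  | .ajmp l => .ajmp l

/-- The PGLD program that is synthesized from the PGA+ program `x` and the vector `α`. -/
def pgap2pgld (θ : IRFS n Instr ≃ Fin K) (act : A → F × M) (irf : F) (meth : IRFMeth A → M)
    {N : NotIndex → ProgLang A} (x : PGAp A) (α : PVector N) : List (DInstr (F × M) (F × M)) :=
  (pglc2pgld (expand θ x α)).mapIdx
      (fun j u => u.translate act irf meth α.length (searchPos θ x α) (j + 1)) ++
    (List.range' 1 α.length).flatMap (fun i => (List.finRange K).flatMap (fun j =>
      [.pos (irf, meth (.eqr ((j : ℕ) + 1))), .ajmp (blockPos θ x α i j)]))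

end

/-- The instruction `u` occurs in the program `P` or in (the projection of) a polyadic instruction
sequence in the vector `α`. -/
def OccursIn {A : Type} {N : NotIndex → ProgLang A} (u : PInstrP A) (P : PGAp A) (α : PVector N) :
    Prop :=
  P.Occurs u ∨ ∃ e ∈ α, ((N e.1).prj e.2).Occurs u

end PolyInSeq

end

open PolyInSeq

/-! Both sides are threads of deterministic transition systems from which silent steps have been
abstracted, so the theorem reduces to a weak bisimulation that respects divergence. Abstracting from
the thread of a system gives the thread of the system obtained by `hide`, in which every state shows
the first non-silent node that it reaches, or inaction if there is none (`abstr_unfold`,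
`hide_hide_rel`). By `hide_rel`, two hidden states are bisimilar as soon as each silent step on one
side is answered by at least one silent step on the other, visible nodes match, and dead states
match.

Before comparison, both executions are slowed down: each jump becomes a silent step of its own, and
a deadlock of the instruction sequence becomes an endless silent loop (`abstr_use_extr`,
`abstr_extrp`). Abstraction turns such loops back into inaction, so nothing is lost, and chains of
jumps need no further analysis.

The bisimulation is `Located`. The register file service is in the state of the polyadic execution,
and the synthesized program is inside a copy of the program being executed, at the same position up
to unfolding of the repetition. There are finitely many register file states, so a copy of every
polyadic sequence, with its get instructions already filled in, is present for each state. A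
switch-over jumps to a list of tests that determines the number of the current state and then enters
the matching copy (`exists_reach_block`). Put instructions keep the state among those numbered by
`θ`. All other instructions are matched one for one (`simulation_step`). -/

namespace PolyInSeq

/-! ### Transition systems -/

section Systems

open Relation

variable {B I X Y : Type}

/-- The node with every continuation replaced by its image. -/
def View.map (f : X → Y) : View B I X → View B I Y
  | .exit => .exit
  | .dead => .dead
  | .act a k => .act a (fun r => f (k r))
  | .int i x => .int i (f x)

/-- Nodes with the same label whose continuations are related. -/
inductive View.Rel (R : X → Y → Prop) : View B I X → View B I Y → Prop
  | exit : View.Rel R .exit .exit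
  | dead : View.Rel R .dead .dead
  | act (a : B) (k : Bool → X) (k' : Bool → Y) (h : ∀ r, R (k r) (k' r)) :
      View.Rel R (.act a k) (.act a k')
  | int (i : I) (x : X) (y : Y) (h : R x y) : View.Rel R (.int i x) (.int i y)

theorem View.Rel.mono {R R' : X → Y → Prop} (h : ∀ x y, R x y → R' x y) {v : View B I X}
    {w : View B I Y} (hv : View.Rel R v w) : View.Rel R' v w := by
  cases hv with
  | exit => exact .exit
  | dead => exact .dead
  | act a k k' hk => exact .act a k k' fun r => h _ _ (hk r)
  | int i x y hx => exact .int i x y (h _ _ hx)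

theorem View.Rel.refl {R : X → X → Prop} (h : ∀ x, R x x) (v : View B I X) : View.Rel R v v := by
  cases v with
  | exit => exact .exit
  | dead => exact .dead
  | act a k => exact .act a k k fun r => h _
  | int i x => exact .int i x x (h _)

theorem View.Rel.map {Z W : Type} {R : Z → W → Prop} (f : X → Z) (g : Y → W) {v : View B I X}
    {w : View B I Y} (h : View.Rel (fun x y => R (f x) (g y)) v w) :
    View.Rel R (v.map f) (w.map g) := by
  cases h with
  | exit => exact .exit
  | dead => exact .dead
  | act a k k' hk => exact .act a _ _ hk
  | int i x y hx => exact .int i _ _ hx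

theorem View.Rel.map_self (f : X → Y) (v : View B I X) :
    View.Rel (fun x y => y = f x) v (v.map f) := by
  cases v with
  | exit => exact .exit
  | dead => exact .dead
  | act a k => exact .act a _ _ fun _ => rfl
  | int i x => exact .int i _ _ rfl

theorem Thread.view_unfold (step : X → View B I X) (s : X) :
    (Thread.unfold step s).view = (step s).map (Thread.unfold step) := by
  unfold Thread.view Thread.unfold
  rw [PFunctor.M.dest_corec]
  cases step s <;> rfl

/-- Coinduction for threads. -/
theorem Thread.eq_of_bisim (R : Thread B I → Thread B I → Prop)
    (h : ∀ x y, R x y → View.Rel R x.view y.view) {x y : Thread B I} (hxy : R x y) : x = y := by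
  refine PFunctor.M.bisim R ?_ x y hxy
  intro x y hxy
  have hv := h x y hxy
  unfold Thread.view at hv
  revert hv
  rcases PFunctor.M.dest x with ⟨a, f⟩
  rcases PFunctor.M.dest y with ⟨b, g⟩
  intro hv
  cases a <;> cases b <;> simp only [View.ofObj] at hv <;> cases hv
  · exact ⟨_, _, _, rfl, rfl, fun i => i.elim⟩
  · exact ⟨_, _, _, rfl, rfl, fun i => i.elim⟩
  · next hk => exact ⟨_, _, _, rfl, rfl, hk⟩
  · next hk => exact ⟨_, _, _, rfl, rfl, fun _ => hk⟩

/-- Bisimilar states have the same thread. -/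
theorem Thread.unfold_eq_unfold {f : X → View B I X} {g : Y → View B I Y} (R : X → Y → Prop)
    (h : ∀ x y, R x y → View.Rel R (f x) (g y)) {x : X} {y : Y} (hxy : R x y) :
    Thread.unfold f x = Thread.unfold g y := by
  refine Thread.eq_of_bisim
    (fun a b => ∃ x y, R x y ∧ a = Thread.unfold f x ∧ b = Thread.unfold g y) ?_
    ⟨x, y, hxy, rfl, rfl⟩
  rintro _ _ ⟨x, y, hxy, rfl, rfl⟩
  rw [Thread.view_unfold, Thread.view_unfold]
  exact ((h x y hxy).mono fun a b hab => ⟨a, b, hab, rfl, rfl⟩).map _ _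

/-! ### Hiding silent steps of deterministic systems -/

/-- An internal step with a label from `S`. -/
def Silent (step : X → View B I X) (S : Set I) (x y : X) : Prop := ∃ ι ∈ S, step x = .int ι y

/-- The nodes that are not an internal step with a label from `S`. -/
def View.Visible (S : Set I) (v : View B I X) : Prop := ∀ ι ∈ S, ∀ y, v ≠ .int ι y

/-- The node `v` is visible and is reached from `x` by finitely many silent steps. -/
def Emits (step : X → View B I X) (S : Set I) (x : X) (v : View B I X) : Prop :=
  v.Visible S ∧ ∃ y, ReflTransGen (Silent step S) x y ∧ step y = v

open Classical in
/-- The transition system in which the internal steps with labels from `S` are skipped. -/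
noncomputable def hide (step : X → View B I X) (S : Set I) (x : X) : View B I X :=
  if h : ∃ v, Emits step S x v then h.choose else .dead

variable {step : X → View B I X} {S : Set I}

/-- A state has a single node, so silent steps are deterministic. This is what makes the emitted
node unique and lets divergence be decided along one path. -/
theorem Silent.unique {x y z : X} (h : Silent step S x y) (h' : Silent step S x z) : y = z := by
  obtain ⟨ι, -, h⟩ := h
  obtain ⟨κ, -, h'⟩ := h'
  rw [h] at h'
  cases h'
  rfl

theorem View.Visible.not_silent {x y : X} (h : (step x).Visible S) : ¬ Silent step S x y := by
  rintro ⟨ι, hι, e⟩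
  exact h ι hι y e

theorem Emits.of_visible {x : X} (h : (step x).Visible S) : Emits step S x (step x) :=
  ⟨h, x, .refl, rfl⟩

theorem emits_iff_of_silent {x y : X} {v : View B I X} (h : Silent step S x y) :
    Emits step S x v ↔ Emits step S y v := by
  constructor
  · rintro ⟨hv, z, hz, e⟩
    rcases ReflTransGen.cases_head hz with rfl | ⟨w, hw, hz⟩
    · subst e
      exact (hv.not_silent h).elim
    · exact ⟨hv, z, h.unique hw ▸ hz, e⟩
  · rintro ⟨hv, z, hz, e⟩
    exact ⟨hv, z, .head h hz, e⟩

theorem Emits.eq_of_visible {x : X} {v : View B I X} (h : (step x).Visible S)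
    (hv : Emits step S x v) : v = step x := by
  obtain ⟨-, z, hz, e⟩ := hv
  rcases ReflTransGen.cases_head hz with rfl | ⟨w, hw, -⟩
  · exact e.symm
  · exact (h.not_silent hw).elim

theorem Emits.unique {x : X} {v w : View B I X} (hv : Emits step S x v) (hw : Emits step S x w) :
    v = w := by
  obtain ⟨hv, z, hz, e⟩ := hv
  induction hz using ReflTransGen.head_induction_on with
  | refl => subst e; exact (hw.eq_of_visible hv).symm
  | head h _ ih => exact ih ((emits_iff_of_silent h).1 hw)

theorem hide_eq {x : X} {v : View B I X} (hv : Emits step S x v) : hide step S x = v := by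
  unfold hide
  have h : ∃ v, Emits step S x v := ⟨v, hv⟩
  rw [dif_pos h]
  exact h.choose_spec.unique hv

theorem hide_eq_dead {x : X} (h : ¬ ∃ v, Emits step S x v) : hide step S x = .dead :=
  dif_neg h

theorem hide_of_visible {x : X} (h : (step x).Visible S) : hide step S x = step x :=
  hide_eq (.of_visible h)

theorem hide_of_silent {x y : X} (h : Silent step S x y) : hide step S x = hide step S y := by
  have e : Emits step S x = Emits step S y := funext fun v => propext (emits_iff_of_silent h)
  unfold hide
  rw [e]

theorem hide_of_reach {x y : X} (h : ReflTransGen (Silent step S) x y) :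
    hide step S x = hide step S y := by
  induction h with
  | refl => rfl
  | tail _ h ih => rw [ih, hide_of_silent h]

/-- A state from which silent steps can be performed forever is inactive. -/
theorem hide_eq_dead_of_invariant (Q : X → Prop) (h : ∀ x, Q x → ∃ y, Silent step S x y ∧ Q y)
    {x : X} (hx : Q x) : hide step S x = .dead := by
  refine hide_eq_dead ?_
  rintro ⟨v, hv, z, hz, e⟩
  induction hz using ReflTransGen.head_induction_on with
  | refl =>
    obtain ⟨y, hy, -⟩ := h _ hx
    subst e
    exact hv.not_silent hy
  | head h' _ ih =>
    obtain ⟨y, hy, hQ⟩ := h _ hx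
    exact ih (h'.unique hy ▸ hQ)

/-- Divergence-preserving weak bisimulations are bisimulations after hiding. -/
theorem hide_rel {f : X → View B I X} {g : Y → View B I Y} {S T : Set I} (R : X → Y → Prop)
    (h : ∀ x y, R x y →
      (∃ y', Silent g T y y' ∧ ∃ x', TransGen (Silent f S) x x' ∧ R x' y') ∨
      (∃ x', ReflTransGen (Silent f S) x x' ∧ (f x').Visible S ∧ (g y).Visible T ∧
        View.Rel R (f x') (g y)) ∨
      (hide f S x = .dead ∧ hide g T y = .dead))
    {x : X} {y : Y} (hxy : R x y) : View.Rel R (hide f S x) (hide g T y) := by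
  by_cases hy : ∃ v, Emits g T y v
  · obtain ⟨v, hv, z, hz, e⟩ := hy
    -- The induction follows the silent path of `y`; `x` varies because it may take several steps
    -- for each step of `y`.
    induction hz using ReflTransGen.head_induction_on generalizing x with
    | refl =>
      rcases h _ _ hxy with ⟨y', hy', -⟩ | ⟨x', hx', hvx, hvy, hR⟩ | ⟨hx, hy⟩
      · subst e
        exact (hv.not_silent hy').elim
      · rw [hide_of_reach hx', hide_of_visible hvx, hide_of_visible hvy]
        exact hR
      · rw [hx, hy]
        exact .dead
    | head h' _ ih =>
      rcases h _ _ hxy with ⟨y', hy', x', hx', hR⟩ | ⟨x', hx', hvx, hvy, hR⟩ | ⟨hx, hy⟩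
      · rw [hide_of_reach hx'.to_reflTransGen, hide_of_silent h']
        exact ih (hy'.unique h' ▸ hR)
      · exact (hvy.not_silent h').elim
      · rw [hx, hy]
        exact .dead
  -- Here `y` emits nothing. A state related to such a `y` must make real progress to another state
  -- of this kind, unless it is already dead after hiding.
  · have key : ∀ x, (∃ y, R x y ∧ ¬ ∃ v, Emits g T y v) → hide f S x ≠ .dead →
        ∃ x', TransGen (Silent f S) x x' ∧ (∃ y, R x' y ∧ ¬ ∃ v, Emits g T y v) := by
      rintro x ⟨y, hxy, hy⟩ hx
      rcases h _ _ hxy with ⟨y', hy', x', hx', hR⟩ | ⟨x', hx', hvx, hvy, hR⟩ | ⟨hx', hy⟩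
      · refine ⟨x', hx', y', hR, ?_⟩
        simpa only [emits_iff_of_silent hy'] using hy
      · exact (hy ⟨_, .of_visible hvy⟩).elim
      · exact (hx hx').elim
    have hdead : hide f S x = .dead := by
      by_contra hne
      have hx : ∃ v, Emits f S x v := by
        by_contra hx
        exact hne (hide_eq_dead hx)
      obtain ⟨v, hv, z, hz, e⟩ := hx
      -- The path from `x` to its visible node is finite and deterministic, so it cannot accommodate
      -- endless progress. The claim covers every state reachable from `x`, since one application of
      -- `key` may run over several silent steps.
      have : ∀ x', ReflTransGen (Silent f S) x x' →
          ¬ ∃ y, R x' y ∧ ¬ ∃ v, Emits g T y v := by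
        clear hxy
        induction hz using ReflTransGen.head_induction_on with
        | refl =>
          intro x' hx' hD
          rw [hide_of_reach hx'] at hne
          obtain ⟨x'', hx'', -⟩ := key _ hD hne
          obtain ⟨w, hw, -⟩ := TransGen.head'_iff.1 (TransGen.trans_right hx' hx'')
          subst e
          exact hv.not_silent hw
        | head h' _ ih =>
          intro x' hx' hD
          rcases ReflTransGen.cases_head hx' with rfl | ⟨w, hw, hx''⟩
          · obtain ⟨x'', hx'', hD'⟩ := key _ hD hne
            obtain ⟨w, hw, hx''⟩ := TransGen.head'_iff.1 hx''
            rw [h'.unique hw] at ih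
            exact ih (by rwa [hide_of_silent hw] at hne) x'' hx'' hD'
          · rw [h'.unique hw] at ih
            exact ih (by rwa [hide_of_silent hw] at hne) x' hx'' hD
      exact this x .refl ⟨y, hxy, hy⟩
    rw [hdead, hide_eq_dead hy]
    exact .dead

theorem View.dead_visible : (View.dead : View B I X).Visible S := fun _ _ _ h => by cases h

theorem hide_of_eq_dead {x : X} (h : step x = .dead) : hide step S x = .dead := by
  rw [hide_of_visible (by rw [h]; exact View.dead_visible), h]

/-- A step with a label from `T` after hiding `S` is a finite run of `S`-steps followed by a
`T`-step. A state that diverges through `S` alone is dead in both systems. -/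
theorem hide_hide_rel {S T : Set I} (x : X) :
    View.Rel Eq (hide step (S ∪ T) x) (hide (hide step S) T x) := by
  refine hide_rel (f := step) (g := hide step S) Eq ?_ rfl
  rintro x _ rfl
  have hsub : ∀ a b, Silent step S a b → Silent step (S ∪ T) a b :=
    fun a b ⟨ι, hι, e⟩ => ⟨ι, .inl hι, e⟩
  by_cases hx : ∃ v, Emits step S x v
  · obtain ⟨v, hv⟩ := hx
    have hh := hide_eq hv
    obtain ⟨hv, z, hz, e⟩ := hv
    have hz' := ReflTransGen.mono hsub _ _ hz
    by_cases hT : v.Visible T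
    · refine .inr (.inl ⟨z, hz', ?_, by rwa [hh], by rw [e, hh]; exact .refl (fun _ => rfl) _⟩)
      rintro ι (hι | hι)
      · rw [e]; exact hv ι hι
      · rw [e]; exact hT ι hι
    · simp only [View.Visible, not_forall, not_not] at hT
      obtain ⟨ι, hι, y, rfl⟩ := hT
      exact .inl ⟨y, ⟨ι, hι, hh⟩, y, TransGen.tail' hz' ⟨ι, .inr hι, e⟩, rfl⟩
  · refine .inr (.inr ⟨?_, hide_of_eq_dead (hide_eq_dead hx)⟩)
    refine hide_eq_dead_of_invariant (fun x => ¬ ∃ v, Emits step S x v) ?_ hx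
    intro x hx
    by_cases hs : ∃ y, Silent step S x y
    · obtain ⟨y, hy⟩ := hs
      exact ⟨y, hsub _ _ hy, by simpa only [emits_iff_of_silent hy] using hx⟩
    · refine (hx ⟨_, .of_visible (x := x) ?_⟩).elim
      intro ι hι y e
      exact hs ⟨y, ι, hι, e⟩

/-! ### Abstraction of threads as hiding -/

theorem settles_iff {ι : I} {x y : Thread B I} :
    Settles ι x y ↔ ReflTransGen (Silent Thread.view {ι}) x y ∧ y.view.Visible {ι} := by
  constructor
  · intro h
    induction h with
    | here x h => exact ⟨.refl, by rintro _ rfl; exact h⟩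
    | hop x y z h _ ih => exact ⟨.head ⟨ι, rfl, h⟩ ih.1, ih.2⟩
  · rintro ⟨h, hv⟩
    induction h using ReflTransGen.head_induction_on with
    | refl => exact .here _ (hv ι rfl)
    | head h _ ih =>
      obtain ⟨_, rfl, e⟩ := h
      exact .hop _ _ _ e ih

theorem abstrStep_eq_hide (ι : I) (x : Thread B I) :
    abstrStep ι x = hide Thread.view {ι} x := by
  unfold abstrStep
  split
  · next h =>
    have := settles_iff.1 h.choose_spec
    exact (hide_eq ⟨this.2, _, this.1, rfl⟩).symm
  · next h =>
    refine (hide_eq_dead ?_).symm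
    rintro ⟨v, hv, z, hz, rfl⟩
    exact h ⟨z, settles_iff.2 ⟨hz, hv⟩⟩

/-- Threads are themselves the states of a transition system with step function `Thread.view`, and
unfolding is a strict bisimulation into it. Hence hiding commutes with unfolding. -/
theorem abstr_unfold (ι : I) (x : X) :
    abstr ι (Thread.unfold step x) = Thread.unfold (hide step {ι}) x := by
  symm
  refine Thread.unfold_eq_unfold (fun x y => y = Thread.unfold step x) ?_ rfl
  rintro x _ rfl
  rw [abstrStep_eq_hide]
  refine hide_rel (fun x y => y = Thread.unfold step x) ?_ rfl
  rintro x _ rfl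
  have hview := Thread.view_unfold step x
  by_cases hv : (step x).Visible {ι}
  · refine .inr (.inl ⟨x, .refl, hv, ?_, ?_⟩)
    · rintro _ rfl y
      have := hv _ rfl
      rw [hview]
      revert this
      cases step x <;> simp [View.map]
      tauto
    · rw [hview]
      exact .map_self _ _
  · simp only [View.Visible, not_forall, not_not] at hv
    obtain ⟨κ, hκ, y, e⟩ := hv
    exact .inl ⟨_, ⟨κ, hκ, by rw [hview, e]; rfl⟩, y, .single ⟨κ, hκ, e⟩, rfl⟩

theorem abstr_abstr_unfold (ι κ : I) (x : X) :
    abstr κ (abstr ι (Thread.unfold step x)) = Thread.unfold (hide step ({ι} ∪ {κ})) x := by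
  rw [abstr_unfold, abstr_unfold]
  symm
  refine Thread.unfold_eq_unfold Eq ?_ rfl
  rintro x _ rfl
  exact hide_hide_rel x

end Systems

/-! ### Execution one instruction at a time -/

section Jumps

open Relation

theorem landing_spec {B T : Type} (s : ℕ → Option (PInstr B T)) (i : ℕ) :
    (landing s i = none ∧ ∀ u j, ¬ Lands s i u j) ∨
      ∃ u j, landing s i = some (u, j) ∧ Lands s i u j := by
  unfold landing
  split
  · next h => exact .inr ⟨_, _, rfl, h.choose_spec⟩
  · next h => exact .inl ⟨rfl, fun u j hl => h ⟨(u, j), hl⟩⟩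

theorem Lands.at_eq {B T : Type} {s : ℕ → Option (PInstr B T)} {i j : ℕ} {u : PInstr B T}
    (h : Lands s i u j) : s j = some u ∧ ∀ l, u ≠ .jmp l := by
  induction h with
  | here i u h hu => exact ⟨h, hu⟩
  | hop i l j u h hl h' ih => exact ih

variable {X Y : Type}

/-- A silent self-loop is the form in which deadlock appears in the slowed-down systems. -/
theorem hide_eq_dead_of_loop {B I : Type} {step : X → View B I X} {S : Set I} {x : X}
    (h : Silent step S x x) : hide step S x = .dead := by
  refine hide_eq_dead_of_invariant (fun y => y = x) ?_ rfl
  rintro _ rfl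
  exact ⟨_, h, rfl⟩

/-- One step of the execution of a PGA program in which jumps are internal actions, and inactivity
is represented by internal actions that are performed forever. -/
def jumpStep {B I : Type} (tau : I) (x : Term (PInstr B B)) (i : ℕ) : View B I ℕ :=
  match x.at i with
  | none => .int tau i
  | some (.plain a) => .act a (fun _ => i + 1)
  | some (.pos a) => .act a (fun r => if r then i + 1 else i + 2)
  | some (.neg a) => .act a (fun r => if r then i + 2 else i + 1)
  | some (.jmp l) => .int tau (i + l)
  | some .halt => .exit

variable {F M I : Type}

open Classical in
/-- The processing of a node by a service in state `s`. -/
noncomputable def useView (tau : I) (f : F) (H : Service M) (v : View (F × M) I X) (s : H.State) :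
    View (F × M) I (X × H.State) :=
  match v with
  | .exit => .exit
  | .dead => .dead
  | .int i x => .int i (x, s)
  | .act a k =>
    if a.1 = f then
      match H.yld a.2 s with
      | .yes => .int tau (k true, H.eff a.2 s)
      | .no => .int tau (k false, H.eff a.2 s)
      | .blocked => .dead
    else .act a (fun r => (k r, s))

/-- One step of the execution of a PGA program that uses a service. -/
noncomputable def useJump (tau : I) (f : F) (H : Service M) (x : Term (PInstr (F × M) (F × M)))
    (p : ℕ × H.State) : View (F × M) I (ℕ × H.State) :=
  useView tau f H (jumpStep tau x p.1) p.2

theorem useView_rel {tau : I} {f : F} {H : Service M} {R : X → Y → Prop}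
    {v : View (F × M) I X} {w : View (F × M) I Y} (h : View.Rel R v w) (s : H.State) :
    View.Rel (fun p q => R p.1 q.1 ∧ p.2 = q.2) (useView tau f H v s) (useView tau f H w s) := by
  cases h with
  | exit => exact .exit
  | dead => exact .dead
  | int i x y h => exact .int _ _ _ ⟨h, rfl⟩
  | act a k k' h =>
    simp only [useView]
    split
    · split
      · exact .int _ _ _ ⟨h _, rfl⟩
      · exact .int _ _ _ ⟨h _, rfl⟩
      · exact .dead
    · exact .act _ _ _ fun r => ⟨h r, rfl⟩

theorem View.Rel.visible {B I : Type} {S : Set I} {R : X → Y → Prop} {v : View B I X}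
    {w : View B I Y} (h : View.Rel R v w) (hv : v.Visible S) : w.Visible S := by
  cases h with
  | exit => rintro _ _ _ ⟨⟩
  | dead => rintro _ _ _ ⟨⟩
  | act => rintro _ _ _ ⟨⟩
  | int i x y h =>
    rintro _ hi _ ⟨⟩
    exact hv _ hi _ rfl

theorem useStep_eq (tau : I) (f : F) (H : Service M) (p : Thread (F × M) I × H.State) :
    useStep tau f H p = useView tau f H p.1.view p.2 := by
  unfold useStep useView
  split <;> simp_all

/-- If the node of `y` is matched by a node reached silently from `x`, it is matched as a silent step
or as a visible node. -/
theorem step_cases {B I : Type} {f : X → View B I X} {g : Y → View B I Y} {S : Set I}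
    {R : X → Y → Prop} {x z : X} {y : Y} (hz : ReflTransGen (Silent f S) x z)
    (h : View.Rel R (f z) (g y)) :
    (∃ y', Silent g S y y' ∧ ∃ x', TransGen (Silent f S) x x' ∧ R x' y') ∨
      (∃ x', ReflTransGen (Silent f S) x x' ∧ (f x').Visible S ∧ (g y).Visible S ∧
        View.Rel R (f x') (g y)) := by
  by_cases hv : (f z).Visible S
  · exact .inr ⟨z, hz, hv, h.visible hv, h⟩
  · simp only [View.Visible, not_forall, not_not] at hv
    obtain ⟨ι, hι, x', e⟩ := hv
    have h' := h
    rw [e] at h'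
    generalize hw : g y = w at h'
    cases h' with
    | int _ _ y' hR => exact .inl ⟨y', ⟨ι, hι, hw⟩, x', .tail' hz ⟨ι, hι, e⟩, hR⟩

theorem Lands.reach_useJump {tau : I} {f : F} {H : Service M} {x : Term (PInstr (F × M) (F × M))}
    {i j : ℕ} {u : PInstr (F × M) (F × M)} (h : Lands x.at i u j) (s : H.State) :
    ReflTransGen (Silent (useJump tau f H x) {tau}) (i, s) (j, s) := by
  induction h with
  | here i u h hu => exact .refl
  | hop i l j u h hl h' ih =>
    refine .head ⟨tau, rfl, ?_⟩ ih
    simp [useJump, jumpStep, useView, h]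

/-- Once the chain of jumps has been followed to its end, the two step functions read the same
non-jump instruction. -/
theorem extrStep_eq_jumpStep {B : Type} (tau : I) {x : Term (PInstr B B)} {i j : ℕ}
    {u : PInstr B B} (hl : landing x.at i = some (u, j)) (h : Lands x.at i u j) :
    extrStep x i = jumpStep tau x j := by
  obtain ⟨hj, hu⟩ := h.at_eq
  unfold extrStep jumpStep
  rw [hl, hj]
  cases u with
  | jmp l => exact (hu l rfl).elim
  | _ => rfl

/-- Jumps leave the service alone, so performing them one by one only inserts `tau` steps. If no
instruction is ever landed on, the inserted steps go on forever and abstraction yields inaction. -/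
theorem abstr_use_extr (tau : I) (f : F) (H : Service M) (x : Term (PInstr (F × M) (F × M))) :
    abstr tau (use tau (extr I x) f H) =
      Thread.unfold (hide (useJump tau f H x) {tau}) (0, H.init) := by
  unfold use
  rw [abstr_unfold]
  symm
  refine Thread.unfold_eq_unfold
    (fun p q => Thread.unfold (extrStep x) p.1 = q.1 ∧ p.2 = q.2) ?_ ⟨rfl, rfl⟩
  intro p q hpq
  refine hide_rel _ ?_ hpq
  rintro ⟨i, s⟩ ⟨_, _⟩ ⟨rfl, rfl⟩
  have hstep : useStep tau f H (Thread.unfold (extrStep x) i, s) =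
      useView tau f H ((extrStep x i).map (Thread.unfold (extrStep x))) s := by
    rw [useStep_eq, Thread.view_unfold]
  rcases landing_spec x.at i with ⟨hl, hno⟩ | ⟨u, j, hl, h⟩
  · refine .inr (.inr ⟨?_, ?_⟩)
    -- Landing nowhere is preserved by each jump, and it rules out all non-jump instructions, so the
    -- next step is always silent.
    · refine hide_eq_dead_of_invariant (fun p => ∀ u j, ¬ Lands x.at p.1 u j) ?_ hno
      rintro ⟨i, s⟩ hno
      simp only [Silent, useJump, jumpStep]
      cases e : x.at i with
      | none => exact ⟨(i, s), ⟨tau, rfl, rfl⟩, hno⟩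
      | some u =>
        cases u with
        | jmp l =>
          refine ⟨(i + l, s), ⟨tau, rfl, rfl⟩, fun u j h => ?_⟩
          by_cases hl : l = 0
          · subst hl; exact hno u j h
          · exact hno u j (.hop i l j u e hl h)
        | _ => exact (hno _ _ (.here i _ e (by rintro _ ⟨⟩))).elim
    · refine hide_of_eq_dead ?_
      rw [hstep]
      simp [extrStep, hl, View.map, useView]
  · have := step_cases (g := useStep tau f H) (y := (Thread.unfold (extrStep x) i, s))
      (R := fun (p : ℕ × H.State) (q : Thread (F × M) I × H.State) =>
        Thread.unfold (extrStep x) p.1 = q.1 ∧ p.2 = q.2)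
      (h.reach_useJump (tau := tau) (f := f) (H := H) s) ?_
    · exact this.imp id .inl
    · rw [hstep, extrStep_eq_jumpStep tau hl h]
      exact (useView_rel (View.Rel.map_self _ _) s).mono fun p q h => ⟨h.1.symm, h.2⟩

variable {A B : Type}

open Classical in
/-- One step of the execution of polyadic instruction sequences in which jumps are internal actions,
and inactivity is represented by internal actions that are performed forever. -/
noncomputable def polyJump (tau gnl : I) (act : A → B) {N : NotIndex → ProgLang A} (α : PVector N)
    (c : Config A) : View B I (Config A) :=
  match c.prog.at c.pos with
  | none => .int tau c
  | some (.plain (.inl a)) => .act (act a) (fun _ => ⟨c.prog, c.pos + 1, c.regs⟩)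
  | some (.pos a) =>
    .act (act a) (fun r => ⟨c.prog, if r then c.pos + 1 else c.pos + 2, c.regs⟩)
  | some (.neg a) =>
    .act (act a) (fun r => ⟨c.prog, if r then c.pos + 2 else c.pos + 1, c.regs⟩)
  | some (.jmp l) => .int tau ⟨c.prog, c.pos + l, c.regs⟩
  | some .halt => .exit
  | some (.plain (.inr (.swo i))) =>
    match α.prj? i with
    | none => .exit
    | some p => if NoGet (p.fill c.regs) then .int gnl ⟨p.fill c.regs, 0, c.regs⟩ else .int tau c
  | some (.plain (.inr (.put i u))) => .int tau ⟨c.prog, c.pos + 1, c.regs.put i u⟩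
  | some (.plain (.inr (.get _))) => .int tau c

theorem Lands.reach_polyJump {tau gnl : I} {act : A → B} {N : NotIndex → ProgLang A}
    {α : PVector N} {S : Set I} (hS : tau ∈ S) {x : PGAp A} {i j : ℕ} {u : PInstrP A}
    (h : Lands x.at i u j) (σ : IRFState A) :
    ReflTransGen (Silent (polyJump tau gnl act α) S) ⟨x, i, σ⟩ ⟨x, j, σ⟩ := by
  induction h with
  | here i u h hu => exact .refl
  | hop i l j u h hl h' ih =>
    refine .head ⟨tau, hS, ?_⟩ ih
    simp [polyJump, h]

/-- The same slowing down for polyadic execution, where also a get instruction and a switch-over to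
a program with remaining get instructions are turned from inaction into silent loops. -/
theorem abstr_extrp (tau gnl : I) (act : A → B) {N : NotIndex → ProgLang A}
    (σ : IRFState A) (α : PVector N) (x : PGAp A) :
    abstr tau (abstr gnl (extrp tau gnl act σ α x)) =
      Thread.unfold (hide (polyJump tau gnl act α) ({gnl} ∪ {tau})) ⟨x, 0, σ⟩ := by
  unfold extrp
  rw [abstr_abstr_unfold]
  symm
  refine Thread.unfold_eq_unfold Eq ?_ rfl
  rintro c _ rfl
  refine hide_rel Eq ?_ rfl
  rintro ⟨x, i, σ⟩ _ rfl
  have hS : tau ∈ ({gnl} ∪ {tau} : Set I) := .inr rfl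
  rcases landing_spec x.at i with ⟨hl, hno⟩ | ⟨u, j, hl, h⟩
  · refine .inr (.inr ⟨?_, ?_⟩)
    · refine hide_eq_dead_of_invariant (fun c => ∀ u j, ¬ Lands c.prog.at c.pos u j) ?_ hno
      rintro ⟨x, i, σ⟩ hno
      simp only [Silent, polyJump]
      dsimp only at hno
      cases e : x.at i with
      | none => exact ⟨_, ⟨tau, hS, rfl⟩, hno⟩
      | some u =>
        cases u with
        | jmp l =>
          refine ⟨_, ⟨tau, hS, rfl⟩, fun u j h => ?_⟩
          by_cases hl : l = 0
          · subst hl; exact hno u j h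
          · exact hno u j (.hop i l j u e hl h)
        | _ => exact (hno _ _ (.here i _ e (by rintro _ ⟨⟩))).elim
    · refine hide_of_eq_dead ?_
      simp [extrpStep, hl]
  · have hr := h.reach_polyJump (gnl := gnl) (act := act) (α := α) hS σ
    obtain ⟨hj, hu⟩ := h.at_eq
    by_cases he : polyJump tau gnl act α ⟨x, j, σ⟩ = extrpStep tau gnl act α ⟨x, i, σ⟩
    · exact (step_cases hr (by rw [he]; exact .refl (fun _ => rfl) _)).imp id .inl
    -- The two nodes differ only at those deadlocks, where one system is inactive and the other
    -- loops.
    · suffices hd : polyJump tau gnl act α ⟨x, j, σ⟩ = .int tau ⟨x, j, σ⟩ ∧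
          extrpStep tau gnl act α ⟨x, i, σ⟩ = .dead by
        refine .inr (.inr ⟨?_, hide_of_eq_dead hd.2⟩)
        rw [hide_of_reach hr]
        exact hide_eq_dead_of_loop ⟨tau, hS, hd.1⟩
      revert he
      simp only [polyJump, extrpStep, hl, hj]
      rcases u with (a | i | ⟨i, u⟩ | i) | a | a | l | _ <;> simp [swoView]
      · cases α.prj? i with
        | none => simp
        | some p => dsimp only; split <;> simp_all
      · exact (hu l rfl).elim

end Jumps

/-! ### Positions in programs -/

section Positions

theorem Term.canon_map {U V : Type} (f : U → V) (x : Term U) :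
    (x.map f).canon = (x.canon.1.map f, x.canon.2.map f) := by
  induction x with
  | instr u => rfl
  | conc x y ihx ihy =>
    simp only [Term.map, Term.canon, ihx, ihy, List.map_eq_nil_iff]
    split <;> simp
  | rep x ih =>
    simp only [Term.map, Term.canon, ih, List.map_eq_nil_iff]
    split <;> simp

theorem Term.at_map {U V : Type} (f : U → V) (x : Term U) (i : ℕ) :
    (x.map f).at i = (x.at i).map f := by
  unfold Term.at
  simp only [Term.canon_map, List.length_map, List.getElem?_map]
  split <;> rfl

theorem Term.canon_ofList {U : Type} (us : List U) (v : U) :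
    (Term.ofList us v).canon = (us ++ [v], []) := by
  induction us with
  | nil => rfl
  | cons u us ih =>
    have : Term.ofList (u :: us) v = .conc (.instr u) (.ofList us v) := rfl
    simp [this, Term.canon, ih]

theorem Term.at_eq_none {U : Type} {x : Term U} {i : ℕ} (hq : x.canon.2 = [])
    (hi : x.canon.1.length ≤ i) : x.at i = none := by
  unfold Term.at
  rw [if_neg (by omega), hq]
  rfl

/-- The positions `i` and `j` of a program that consists of `p` instructions followed by the
repetition of `q` instructions are the same up to the unfolding of the repetition. -/
def SamePos (p q i j : ℕ) : Prop := i = j ∨ p ≤ i ∧ p ≤ j ∧ i ≡ j [MOD q]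

theorem SamePos.add {p q i j : ℕ} (h : SamePos p q i j) (l : ℕ) :
    SamePos p q (i + l) (j + l) := by
  rcases h with rfl | ⟨hi, hj, h⟩
  · exact .inl rfl
  · exact .inr ⟨by omega, by omega, h.add_right l⟩

theorem SamePos.trans {p q i j k : ℕ} (h : SamePos p q i j) (h' : SamePos p q j k) :
    SamePos p q i k := by
  rcases h with rfl | ⟨hi, hj, h⟩
  · exact h'
  · rcases h' with rfl | ⟨-, hk, h'⟩
    · exact .inr ⟨hi, hj, h⟩
    · exact .inr ⟨hi, hk, h.trans h'⟩

theorem SamePos.fold (p q i : ℕ) (hi : p ≤ i) : SamePos p q i (p + (i - p) % q) := by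
  refine .inr ⟨hi, by omega, ?_⟩
  have := (Nat.mod_modEq (i - p) q).symm.add_left p
  rwa [Nat.add_sub_cancel' hi] at this

/-- The bound on `j` puts it in the finite prefix or the first copy of the repeated part, so `j` is
the representative of `i` that can be looked up in the embedded program. -/
theorem Term.at_of_samePos {U : Type} {x : Term U} {i j : ℕ}
    (h : SamePos x.canon.1.length x.canon.2.length i j)
    (hj : j < x.canon.1.length + x.canon.2.length) :
    x.at i = (x.canon.1 ++ x.canon.2)[j]? := by
  unfold Term.at
  by_cases hp : j < x.canon.1.length
  · rcases h with rfl | ⟨-, hj', -⟩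
    · rw [if_pos hp, List.getElem?_append_left hp]
    · omega
  · have hi : x.canon.1.length ≤ i := by rcases h with rfl | ⟨h, -⟩ <;> omega
    have hmod : (i - x.canon.1.length) % x.canon.2.length = j - x.canon.1.length := by
      rcases h with rfl | ⟨-, -, h⟩
      · exact Nat.mod_eq_of_lt (by omega)
      · have h' : i - x.canon.1.length ≡ j - x.canon.1.length [MOD x.canon.2.length] := by
          refine Nat.ModEq.add_left_cancel' x.canon.1.length ?_
          rwa [Nat.add_sub_cancel' hi, Nat.add_sub_cancel' (by omega)]
        exact Eq.trans h' (Nat.mod_eq_of_lt (by omega))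
    rw [if_neg (by omega), List.getElem?_append_right (by omega), hmod]

variable {B T : Type}

/-- The period is the program length plus two, for the two appended termination instructions.
Positions in the projection therefore matter only up to this modulus. -/
theorem at_pgld2pga {us : List (DInstr B T)} {i : ℕ} {u : DInstr B T}
    (h : us[i % (us.length + 2)]? = some u) :
    (pgld2pga us).at i = some (u.toPGA us.length (i % (us.length + 2) + 1)) := by
  have hlt : i % (us.length + 2) < us.length := (List.getElem?_eq_some_iff.1 h).1
  unfold pgld2pga Term.at
  set us' := us.mapIdx (fun j u => u.toPGA us.length (j + 1)) with hus'
  have hcanon : (Term.rep (Term.ofList (us' ++ [.halt]) .halt)).canon =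
      ([], us' ++ [.halt] ++ [.halt]) := by
    simp [Term.canon, Term.canon_ofList]
  have hlen : (us' ++ [.halt] ++ [.halt] : List (PInstr B T)).length = us.length + 2 := by
    simp [hus']
  rw [hcanon]
  dsimp only
  rw [if_neg (by simp), hlen, List.length_nil, Nat.sub_zero]
  rw [List.getElem?_append_left (by simp [hus']; omega),
    List.getElem?_append_left (by simpa [hus'] using hlt), hus', List.getElem?_mapIdx, h]
  rfl

theorem length_pga2pglc (x : Term (PInstr B T)) :
    (pga2pglc x).length = x.canon.1.length + x.canon.2.length + 2 := by
  unfold pga2pglc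
  dsimp only
  split <;> simp

theorem pga2pglc_getElem? (x : Term (PInstr B T)) {j : ℕ}
    (h : j < x.canon.1.length + x.canon.2.length) :
    (pga2pglc x)[j]? = ((x.canon.1 ++ x.canon.2)[j]?).map
      (fun u => u.toPGLC x.canon.1.length x.canon.2.length (j + 1)) := by
  unfold pga2pglc
  dsimp only
  rw [List.getElem?_append_left (by simpa using h), List.getElem?_mapIdx]

/-- Two closing instructions are needed because a test at the last position of the program can skip
one of them. -/
theorem pga2pglc_getElem?_of_le (x : Term (PInstr B T)) {j : ℕ}
    (h : x.canon.1.length + x.canon.2.length ≤ j)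
    (h' : j < x.canon.1.length + x.canon.2.length + 2) :
    (pga2pglc x)[j]? =
      some (if x.canon.2 = [] then .fjmp 0 else .bjmp x.canon.2.length) := by
  unfold pga2pglc
  dsimp only
  rw [List.getElem?_append_right (by simpa using h)]
  have : j - (x.canon.1.length + x.canon.2.length) = 0 ∨
    j - (x.canon.1.length + x.canon.2.length) = 1 := by omega
  simp only [List.length_mapIdx, List.length_append]
  split <;> rcases this with e | e <;> rw [e] <;> rfl

/-- Relative jumps are insensitive to the offset `o` at which a block is placed; making them
absolute adds `o` to the target. -/
theorem toPGLD_goto {k o i j : ℕ} (hj : o + j < k) :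
    (CInstr.goto (B := B) (T := T) (i + 1) (j + 1)).toPGLD k (o + i + 1) = .ajmp (o + j + 1) := by
  unfold CInstr.goto
  split <;> simp only [CInstr.toPGLD]
  · rw [if_pos (by omega)]; congr 1; omega
  · rw [if_pos (by omega)]; congr 1; omega

theorem pglc2pgld_getElem? {us pre post : List (CInstr B T)} {vs : List (CInstr B T)}
    (h : us = pre ++ vs ++ post) {j : ℕ} {u : CInstr B T} (hu : vs[j]? = some u) :
    (pglc2pgld us)[pre.length + j]? = some (u.toPGLD us.length (pre.length + j + 1)) := by
  have hj : j < vs.length := (List.getElem?_eq_some_iff.1 hu).1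
  unfold pglc2pgld
  rw [List.getElem?_mapIdx]
  have : us[pre.length + j]? = some u := by
    rw [h, List.append_assoc, List.getElem?_append_right (by omega),
      Nat.add_sub_cancel_left, List.getElem?_append_left hj, hu]
  rw [this]
  rfl

/-! ### Concatenations of indexed families of lists -/

/-- The length of the prefix is put in the form of the sum that occurs in `blockPos`. -/
theorem exists_flatMap_finRange_eq {γ : Type} : ∀ {K : ℕ} (g : Fin K → List γ) (j : Fin K),
    ∃ pre post, (List.finRange K).flatMap g = pre ++ g j ++ post ∧
      pre.length = ∑ i ∈ Finset.univ.filter (fun i : Fin K => i < j), (g i).length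
  | 0, _, j => j.elim0
  | K + 1, g, j => by
    rw [List.finRange_succ, List.flatMap_cons, List.flatMap_map, Finset.sum_filter]
    cases j using Fin.cases with
    | zero => exact ⟨[], _, rfl, by simp⟩
    | succ j =>
      obtain ⟨pre, post, e, hl⟩ := exists_flatMap_finRange_eq (fun i => g i.succ) j
      rw [Finset.sum_filter] at hl
      refine ⟨g 0 ++ pre, post, by rw [e]; simp, ?_⟩
      rw [Fin.sum_univ_succ]
      simp [hl, Fin.succ_lt_succ_iff]

theorem length_flatMap_finRange {γ : Type} {K : ℕ} (g : Fin K → List γ) :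
    ((List.finRange K).flatMap g).length = ∑ i, (g i).length := by
  rw [List.length_flatMap, Fin.sum_univ_def]

theorem length_flatMap_range' {γ : Type} (n : ℕ) (g : ℕ → List γ) :
    ((List.range' 1 n).flatMap g).length = ∑ i ∈ Finset.Icc 1 n, (g i).length := by
  induction n with
  | zero => rfl
  | succ n ih =>
    rw [List.range'_1_concat, List.flatMap_append, List.length_append, ih,
      Finset.sum_Icc_succ_top (by omega), Nat.add_comm 1 n]
    simp

theorem exists_flatMap_range'_eq {γ : Type} {n i : ℕ} (hi : 1 ≤ i) (hn : i ≤ n)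
    (g : ℕ → List γ) :
    ∃ pre post, (List.range' 1 n).flatMap g = pre ++ g i ++ post ∧
      pre.length = ∑ h ∈ Finset.Icc 1 (i - 1), (g h).length := by
  obtain ⟨i, rfl⟩ := Nat.exists_eq_add_of_le' hi
  obtain ⟨m, rfl⟩ := Nat.exists_eq_add_of_le hn
  refine ⟨_, (List.range' (i + 2) m).flatMap g, ?_, length_flatMap_range' i g⟩
  have : List.range' 1 (i + 1 + m) = List.range' 1 i ++ [i + 1] ++ List.range' (i + 2) m := by
    rw [← List.range'_append_1, List.range'_1_concat, Nat.add_comm 1 i,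
      show 1 + (i + 1) = i + 2 by omega]
  simp [this]

end Positions

/-! ### Execution of PGLD programs that use a service -/

section Machine

open Relation

variable {F M I : Type} {tau : I} {f : F} {H : Service M}
  {us : List (DInstr (F × M) (F × M))} {i : ℕ}

theorem useJump_halt (h : us[i % (us.length + 2)]? = some (.ajmp 0)) (s : H.State) :
    useJump tau f H (pgld2pga us) (i, s) = .exit := by
  simp [useJump, jumpStep, at_pgld2pga h, DInstr.toPGA, useView]

theorem useJump_loop (h : us[i % (us.length + 2)]? = some (.ajmp (i % (us.length + 2) + 1)))
    (s : H.State) : useJump tau f H (pgld2pga us) (i, s) = .int tau (i, s) := by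
  have hlt : i % (us.length + 2) < us.length := (List.getElem?_eq_some_iff.1 h).1
  have hc : ¬ (i % (us.length + 2) + 1 = 0 ∨ us.length < i % (us.length + 2) + 1) := by omega
  simp only [useJump, jumpStep, at_pgld2pga h, DInstr.toPGA, if_neg hc, le_refl, if_true,
    Nat.sub_self, useView, Nat.add_zero]

/-- A backward jump runs forward into the next copy of the repetition, so the target is determined
only modulo the period. -/
theorem useJump_ajmp {t : ℕ} (h : us[i % (us.length + 2)]? = some (.ajmp (t + 1)))
    (ht : t < us.length) (s : H.State) :
    ∃ i', i' % (us.length + 2) = t ∧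
      Silent (useJump tau f H (pgld2pga us)) {tau} (i, s) (i', s) := by
  have hlt : i % (us.length + 2) < us.length := (List.getElem?_eq_some_iff.1 h).1
  have hc : ¬ (t + 1 = 0 ∨ us.length < t + 1) := by omega
  have hat := at_pgld2pga h
  simp only [DInstr.toPGA, if_neg hc] at hat
  have hi := Nat.div_add_mod i (us.length + 2)
  set m := i % (us.length + 2) with hm
  split at hat
  · refine ⟨_, ?_, tau, rfl, by simp only [useJump, jumpStep, hat, useView]; rfl⟩
    rw [← hi, show (us.length + 2) * (i / (us.length + 2)) + m + (t + 1 - (m + 1)) =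
      t + (us.length + 2) * (i / (us.length + 2)) by omega, Nat.add_mul_mod_self_left]
    exact Nat.mod_eq_of_lt (by omega)
  · refine ⟨_, ?_, tau, rfl, by simp only [useJump, jumpStep, hat, useView]; rfl⟩
    rw [← hi, show (us.length + 2) * (i / (us.length + 2)) + m +
        (us.length + 2 - (m + 1 - (t + 1))) =
      t + (us.length + 2) + (us.length + 2) * (i / (us.length + 2)) by omega,
      Nat.add_mul_mod_self_left, Nat.add_mod_right]
    exact Nat.mod_eq_of_lt (by omega)

theorem add_mod_of_lt {k i d : ℕ} (h : i % k + d < k) : (i + d) % k = i % k + d := by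
  rw [Nat.add_mod, Nat.mod_eq_of_lt (a := d) (by omega), Nat.mod_eq_of_lt h]

theorem useJump_plain {a : F × M} (h : us[i % (us.length + 2)]? = some (.plain a)) (s : H.State) :
    useJump tau f H (pgld2pga us) (i, s) =
      useView tau f H (.act a (fun _ => i + 1)) s := by
  simp only [useJump, jumpStep, at_pgld2pga h, DInstr.toPGA]

theorem useJump_pos {a : F × M} (h : us[i % (us.length + 2)]? = some (.pos a)) (s : H.State) :
    useJump tau f H (pgld2pga us) (i, s) =
      useView tau f H (.act a (fun r => if r then i + 1 else i + 2)) s := by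
  simp only [useJump, jumpStep, at_pgld2pga h, DInstr.toPGA]

theorem useJump_neg {a : F × M} (h : us[i % (us.length + 2)]? = some (.neg a)) (s : H.State) :
    useJump tau f H (pgld2pga us) (i, s) =
      useView tau f H (.act a (fun r => if r then i + 2 else i + 1)) s := by
  simp only [useJump, jumpStep, at_pgld2pga h, DInstr.toPGA]

theorem useView_act_of_ne {X : Type} {a : F × M} (ha : a.1 ≠ f) (k : Bool → X) (s : H.State) :
    useView tau f H (.act a k) s = .act a (fun r => (k r, s)) := by
  simp only [useView, if_neg ha]

end Machine

/-! ### Replies and effects of the register file service -/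

section Register

variable {A F M I : Type} {n : ℕ} {Instr : Finset (CPInstr A)} {K : ℕ}
  {θ : IRFS n Instr ≃ Fin K} {meth : IRFMeth A → M}

/-- Decoding picks some accepted method with the given name; distinctness of the names makes it the
intended one. -/
theorem decode_meth (hmeth : Set.InjOn meth (methIRF n Instr K)) (μ : methIRF n Instr K) :
    decode n Instr K meth (meth μ) = some μ := by
  unfold decode
  have h : ∃ ν : methIRF n Instr K, meth ν = meth μ := ⟨μ, rfl⟩
  rw [dif_pos h]
  exact congrArg some (Subtype.ext (hmeth h.choose.2 μ.2 h.choose_spec))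

theorem useView_put (hmeth : Set.InjOn meth (methIRF n Instr K)) {X : Type} (tau : I) (f : F)
    {r : ℕ} {u : CPInstr A} (hr : 1 ≤ r ∧ r ≤ n) (hu : u ∈ Instr) (k : Bool → X)
    (s : Option (IRFS n Instr)) (τ : IRFS n Instr) :
    useView tau f (irfService θ meth s) (.act (f, meth (.put r u)) k) (some τ) =
      .int tau (k true, some ⟨τ.1.put r u, IRFS.put_mem τ.2 hr hu⟩) := by
  have hd := decode_meth hmeth ⟨.put r u, hr, hu⟩
  dsimp only at hd
  have hy : (irfService θ meth s).yld (meth (.put r u)) (some τ) = .yes := by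
    simp only [irfService, irfYld, hd, methYld]
  have he : (irfService θ meth s).eff (meth (.put r u)) (some τ) =
      some ⟨τ.1.put r u, IRFS.put_mem τ.2 hr hu⟩ := by
    simp only [irfService, irfEff, hd, methEff]
  unfold useView
  dsimp only
  rw [if_pos rfl, hy, he]

theorem useView_eqr (hmeth : Set.InjOn meth (methIRF n Instr K)) {X : Type} (tau : I) (f : F)
    (j : Fin K) (k : Bool → X) (s : Option (IRFS n Instr)) (τ : IRFS n Instr) :
    useView tau f (irfService θ meth s) (.act (f, meth (.eqr ((j : ℕ) + 1))) k) (some τ) =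
      .int tau (k (decide (θ τ = j)), some τ) := by
  have hd := decode_meth hmeth (⟨.eqr ((j : ℕ) + 1), by omega, by omega⟩ : methIRF n Instr K)
  dsimp only at hd
  have hy : (irfService θ meth s).yld (meth (.eqr ((j : ℕ) + 1))) (some τ) =
      if θ τ = j then .yes else .no := by
    simp only [irfService, irfYld, hd, methYld, Nat.add_right_cancel_iff, Fin.val_inj]
  have he : (irfService θ meth s).eff (meth (.eqr ((j : ℕ) + 1))) (some τ) = some τ := by
    simp only [irfService, irfEff, hd, methEff]
  unfold useView
  dsimp only
  rw [if_pos rfl, hy, he]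
  by_cases h : θ τ = j <;> simp [h]

end Register

/-! ### Layout of the synthesized program -/

section Layout

open Relation

variable {A F M I : Type} {n : ℕ} {Instr : Finset (CPInstr A)} {K : ℕ}
  (θ : IRFS n Instr ≃ Fin K) (act : A → F × M) (irf : F) (meth : IRFMeth A → M)
  {N : NotIndex → ProgLang A} (P : PGAp A) (α : PVector N)

theorem length_expand : (expand θ P α).length =
    (pga2pglc P).length + ∑ h ∈ Finset.Icc 1 α.length, ∑ j : Fin K, (block θ α h j).length := by
  unfold expand
  rw [List.length_append, length_flatMap_range']
  simp only [length_flatMap_finRange]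

theorem exists_expand_eq_block {i : ℕ} (hi : 1 ≤ i) (hi' : i ≤ α.length) (j : Fin K) :
    ∃ pre post, expand θ P α = pre ++ block θ α i j ++ post ∧
      blockPos θ P α i j = pre.length + 1 := by
  obtain ⟨pre, post, e, hl⟩ := exists_flatMap_range'_eq hi hi'
    (fun i => (List.finRange K).flatMap (fun j => block θ α i j))
  obtain ⟨pre', post', e', hl'⟩ := exists_flatMap_finRange_eq (fun j => block θ α i j) j
  refine ⟨pga2pglc P ++ pre ++ pre', post' ++ post, ?_, ?_⟩
  · unfold expand
    rw [e, e']
    simp only [List.append_assoc]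
  · unfold blockPos
    simp only [length_flatMap_finRange] at hl
    rw [List.length_append, List.length_append, hl, hl']

theorem pgap2pgld_getElem?_of_expand {pre vs post : List (CInstr (A ⊕ SBInstr A) A)}
    (h : expand θ P α = pre ++ vs ++ post) {j : ℕ} {u : CInstr (A ⊕ SBInstr A) A}
    (hu : vs[j]? = some u) :
    (pgap2pgld θ act irf meth P α)[pre.length + j]? =
      some ((u.toPGLD (expand θ P α).length (pre.length + j + 1)).translate act irf meth α.length
        (searchPos θ P α) (pre.length + j + 1)) := by
  have h' := pglc2pgld_getElem? h hu
  have hlt := (List.getElem?_eq_some_iff.1 h').1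
  unfold pgap2pgld
  rw [List.getElem?_append_left (by simpa using hlt), List.getElem?_mapIdx, h']
  rfl

/-- Every state contributes a test and a jump, hence the stride 2. The list index `t` counts from 0,
whereas `searchPos` counts from 1. -/
theorem pgap2pgld_getElem?_search {i : ℕ} (hi : 1 ≤ i) (hi' : i ≤ α.length) (j : Fin K) :
    ∃ t, t + 1 = searchPos θ P α i + 2 * j ∧
      (pgap2pgld θ act irf meth P α)[t]? = some (.pos (irf, meth (.eqr ((j : ℕ) + 1)))) ∧
      (pgap2pgld θ act irf meth P α)[t + 1]? = some (.ajmp (blockPos θ P α i j)) := by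
  obtain ⟨pre, post, e, hl⟩ := exists_flatMap_range'_eq hi hi'
    (fun i => (List.finRange K).flatMap (fun j : Fin K =>
      [DInstr.pos (B := F × M) (irf, meth (.eqr ((j : ℕ) + 1))), .ajmp (blockPos θ P α i j)]))
  obtain ⟨pre', post', e', hl'⟩ := exists_flatMap_finRange_eq (fun j : Fin K =>
      [DInstr.pos (B := F × M) (irf, meth (.eqr ((j : ℕ) + 1))), .ajmp (blockPos θ P α i j)]) j
  simp only [length_flatMap_finRange, List.length_cons, List.length_nil, Finset.sum_const,
    Finset.card_univ, Fintype.card_fin, Nat.card_Icc, smul_eq_mul, Finset.filter_gt_eq_Iio, Fin.card_Iio] at hl hl'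
  have hlen := length_expand θ P α
  set E := (pglc2pgld (expand θ P α)).mapIdx
      (fun j u => u.translate act irf meth α.length (searchPos θ P α) (j + 1)) with hE
  have hEl : E.length = (expand θ P α).length := by simp [hE, pglc2pgld]
  have hD : pgap2pgld θ act irf meth P α = (E ++ pre ++ pre') ++
      [DInstr.pos (irf, meth (.eqr ((j : ℕ) + 1))), .ajmp (blockPos θ P α i j)] ++
        (post' ++ post) := by
    unfold pgap2pgld
    rw [e, e']
    simp only [List.append_assoc, hE]
  refine ⟨(E ++ pre ++ pre').length, ?_, ?_, ?_⟩
  · unfold searchPos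
    rw [List.length_append, List.length_append, hEl, hl, hl', hlen,
      Nat.add_sub_cancel, show 2 * K * (i - 1) = (i - 1) * (K * (0 + 1 + 1)) by ring]
    ring
  · rw [hD, List.append_assoc, List.getElem?_append_right le_rfl]
    simp
  · rw [hD, List.append_assoc, List.getElem?_append_right (by omega)]
    simp

theorem length_expand_le : (expand θ P α).length ≤ (pgap2pgld θ act irf meth P α).length := by
  unfold pgap2pgld
  simp [pglc2pgld]

end Layout

/-! ### The simulation -/

section Simulation

open Relation

variable {A F M I : Type} {n : ℕ} {Instr : Finset (CPInstr A)} {K : ℕ}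
  (tau gnl : I) (θ : IRFS n Instr ≃ Fin K) (act : A → F × M) (irf : F) (meth : IRFMeth A → M)
  {N : NotIndex → ProgLang A} (P : PGAp A) (α : PVector N)

/-- The execution of the synthesized program, with an instruction register file service. -/
noncomputable def synthStep (p : ℕ × Option (IRFS n Instr)) :
    View (F × M) I (ℕ × Option (IRFS n Instr)) :=
  useJump tau irf (irfService θ meth none) (pgld2pga (pgap2pgld θ act irf meth P α)) p

/-- The 0-based position in the synthesized program that corresponds to position `i` of its
projection to PGA. -/
noncomputable def synthPos (i : ℕ) : ℕ := i % ((pgap2pgld θ act irf meth P α).length + 2)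

/-- All registers and instructions in put instructions are available in the register file. -/
def PutsIn (n : ℕ) (Instr : Finset (CPInstr A)) (x : PGAp A) : Prop :=
  ∀ i u, x.Occurs (iPut i u) → (1 ≤ i ∧ i ≤ n) ∧ u ∈ Instr

/-- Execution of the synthesized program at position `i` is in the PGLC version of the program `x`,
which comes after `pre`, at the `j`-th instruction. -/
structure AtBlock (x : PGAp A) (pre : List (CInstr (A ⊕ SBInstr A) A)) (i j : ℕ) : Prop where
  split : ∃ post, expand θ P α = pre ++ pga2pglc x ++ post
  pos_eq : synthPos θ act irf meth P α i = pre.length + j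
  lt : j < (pga2pglc x).length

/-- The execution states of the synthesized program that correspond to a configuration. -/
def Located (p : ℕ × Option (IRFS n Instr)) (c : Config A) : Prop :=
  ∃ pre j τ, p.2 = some τ ∧ c.regs = τ.1 ∧ AtBlock θ act irf meth P α c.prog pre p.1 j ∧
    SamePos c.prog.canon.1.length c.prog.canon.2.length c.pos j ∧ PutsIn n Instr c.prog

variable {tau gnl θ act irf meth P α}

theorem AtBlock.getElem?_eq {x : PGAp A} {pre : List (CInstr (A ⊕ SBInstr A) A)} {i j : ℕ}
    (h : AtBlock θ act irf meth P α x pre i j) {u : CInstr (A ⊕ SBInstr A) A}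
    (hu : (pga2pglc x)[j]? = some u) :
    (pgap2pgld θ act irf meth P α)[synthPos θ act irf meth P α i]? =
      some ((u.toPGLD (expand θ P α).length (pre.length + j + 1)).translate act irf meth α.length
        (searchPos θ P α) (pre.length + j + 1)) := by
  obtain ⟨post, e⟩ := h.split
  rw [h.pos_eq, pgap2pgld_getElem?_of_expand θ act irf meth P α e hu]

theorem AtBlock.lt_expand {x : PGAp A} {pre : List (CInstr (A ⊕ SBInstr A) A)} {i j : ℕ}
    (h : AtBlock θ act irf meth P α x pre i j) {k : ℕ} (hk : k < (pga2pglc x).length) :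
    pre.length + k < (expand θ P α).length := by
  obtain ⟨post, e⟩ := h.split
  rw [e]
  simp only [List.length_append]
  omega

/-- As long as execution stays inside the block, advancing does not wrap around the period of the
projection. -/
theorem AtBlock.add {x : PGAp A} {pre : List (CInstr (A ⊕ SBInstr A) A)} {i j d : ℕ}
    (h : AtBlock θ act irf meth P α x pre i j) (hd : j + d < (pga2pglc x).length) :
    AtBlock θ act irf meth P α x pre (i + d) (j + d) := by
  refine ⟨h.split, ?_, hd⟩
  have h1 := h.lt_expand hd
  have h2 := length_expand_le θ act irf meth P α
  have h3 := h.pos_eq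
  unfold synthPos at h3 ⊢
  rw [add_mod_of_lt (by omega), h3, Nat.add_assoc]

/-- A jump within a block. -/
theorem AtBlock.jump {x : PGAp A} {pre : List (CInstr (A ⊕ SBInstr A) A)} {i j k : ℕ}
    (h : AtBlock θ act irf meth P α x pre i j) {u : CInstr (A ⊕ SBInstr A) A}
    (hu : (pga2pglc x)[j]? = some u)
    (hk : u.toPGLD (expand θ P α).length (pre.length + j + 1) = .ajmp (pre.length + k + 1))
    (hlt : k < (pga2pglc x).length) (s : Option (IRFS n Instr)) :
    ∃ i', AtBlock θ act irf meth P α x pre i' k ∧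
      Silent (synthStep tau θ act irf meth P α) {tau} (i, s) (i', s) := by
  have h' := h.getElem?_eq hu
  rw [hk] at h'
  have hlt' := h.lt_expand hlt
  have hle := length_expand_le θ act irf meth P α
  obtain ⟨i', hi', hs⟩ := useJump_ajmp (tau := tau) (f := irf) (H := irfService θ meth none)
    h' (by omega) s
  exact ⟨i', ⟨h.split, hi', hlt⟩, hs⟩

/-- An inactive jump. -/
theorem AtBlock.loop {x : PGAp A} {pre : List (CInstr (A ⊕ SBInstr A) A)} {i j : ℕ}
    (h : AtBlock θ act irf meth P α x pre i j) {u : CInstr (A ⊕ SBInstr A) A}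
    (hu : (pga2pglc x)[j]? = some u)
    (hk : (u.toPGLD (expand θ P α).length (pre.length + j + 1)).translate act irf meth α.length
        (searchPos θ P α) (pre.length + j + 1) = .ajmp (pre.length + j + 1))
    (s : Option (IRFS n Instr)) :
    hide (synthStep tau θ act irf meth P α) {tau} (i, s) = .dead := by
  have h' := h.getElem?_eq hu
  rw [hk, ← h.pos_eq] at h'
  exact hide_eq_dead_of_loop ⟨tau, rfl, useJump_loop (tau := tau) (f := irf)
    (H := irfService θ meth none) h' s⟩

theorem AtBlock.loop_fjmp {x : PGAp A} {pre : List (CInstr (A ⊕ SBInstr A) A)} {i j : ℕ}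
    (h : AtBlock θ act irf meth P α x pre i j) (hu : (pga2pglc x)[j]? = some (.fjmp 0))
    (s : Option (IRFS n Instr)) :
    hide (synthStep tau θ act irf meth P α) {tau} (i, s) = .dead := by
  refine h.loop hu ?_ s
  have := h.lt_expand h.lt
  simp only [CInstr.toPGLD]
  rw [if_pos (by omega)]
  rfl

/-- Execution reaches the first copy of the repeated part. -/
theorem AtBlock.fold {x : PGAp A} (hq : x.canon.2 ≠ [])
    {pre : List (CInstr (A ⊕ SBInstr A) A)} (s : Option (IRFS n Instr)) {i j : ℕ}
    (h : AtBlock θ act irf meth P α x pre i j) :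
    ∃ i' j', ReflTransGen (Silent (synthStep tau θ act irf meth P α) {tau}) (i, s) (i', s) ∧
      AtBlock θ act irf meth P α x pre i' j' ∧
      j' < x.canon.1.length + x.canon.2.length ∧
      SamePos x.canon.1.length x.canon.2.length j j' := by
  -- One closing jump may not suffice: if the repeated part has length 1, the second closing jump
  -- leads to the first.
  induction j using Nat.strong_induction_on generalizing i with
  | _ j ih =>
    by_cases hj : j < x.canon.1.length + x.canon.2.length
    · exact ⟨i, j, .refl, h, hj, .inl rfl⟩
    · have hpos : 0 < x.canon.2.length := List.length_pos_iff.2 hq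
      have hlt := h.lt
      rw [length_pga2pglc] at hlt
      have hu := pga2pglc_getElem?_of_le x (not_lt.1 hj) hlt
      rw [if_neg hq] at hu
      obtain ⟨i', hi', hs⟩ := h.jump (tau := tau) (k := j - x.canon.2.length) hu
        (by
          simp only [CInstr.toPGLD]
          rw [if_pos (by omega)]
          congr 1
          omega)
        (by rw [length_pga2pglc]; omega) s
      obtain ⟨i'', j', hr, hb, hj', hsame⟩ := ih _ (by omega) hi'
      refine ⟨i'', j', .head hs hr, hb, hj', SamePos.trans (.inr ⟨by omega, by omega, ?_⟩) hsame⟩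
      have : j - x.canon.2.length + x.canon.2.length ≡ j - x.canon.2.length
        [MOD x.canon.2.length] := by simp [Nat.ModEq]
      rwa [Nat.sub_add_cancel (by omega)] at this

/-- The search for an instance ends at the instance for the current register file state. -/
theorem exists_reach_block (hmeth : Set.InjOn meth (methIRF n Instr K)) {r : ℕ} (hr : 1 ≤ r)
    (hr' : r ≤ α.length) (τ : IRFS n Instr) (d : ℕ) : ∀ (j : Fin K), (j : ℕ) + d = θ τ →
    ∀ i, synthPos θ act irf meth P α i + 1 = searchPos θ P α r + 2 * j →
    ∃ pre i', ReflTransGen (Silent (synthStep tau θ act irf meth P α) {tau})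
        (i, some τ) (i', some τ) ∧
      AtBlock θ act irf meth P α (generate α r τ.1) pre i' 0 := by
  -- `d` counts the tests that still fail before the one for the current state. A failing test skips
  -- the jump after it, so the search advances by 2.
  induction d with
  | zero =>
    intro j hj i hi
    have hj' : θ τ = j := Fin.ext hj.symm
    obtain ⟨t, ht, h1, h2⟩ := pgap2pgld_getElem?_search θ act irf meth P α hr hr' j
    obtain rfl : synthPos θ act irf meth P α i = t := by omega
    obtain ⟨pre, post, e, hb⟩ := exists_expand_eq_block θ P α hr hr' j
    have hblock : block θ α r j = pga2pglc (generate α r τ.1) := by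
      unfold block
      rw [← hj', Equiv.symm_apply_apply]
    have hs1 : Silent (synthStep tau θ act irf meth P α) {tau} (i, some τ) (i + 1, some τ) := by
      refine ⟨tau, rfl, ?_⟩
      unfold synthStep
      refine (useJump_pos (tau := tau) (f := irf) (H := irfService θ meth none) h1
        (some τ)).trans ?_
      refine (useView_eqr hmeth tau irf j _ none τ).trans ?_
      simp [hj']
      rfl
    have hlen : 0 < (pga2pglc (generate α r τ.1)).length := by
      rw [length_pga2pglc]; omega
    have hlt : synthPos θ act irf meth P α i + 1 < (pgap2pgld θ act irf meth P α).length :=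
      (List.getElem?_eq_some_iff.1 h2).1
    have hpos : synthPos θ act irf meth P α (i + 1) = synthPos θ act irf meth P α i + 1 :=
      add_mod_of_lt (Nat.lt_of_lt_of_le hlt (Nat.le_add_right _ _))
    have hle := length_expand_le θ act irf meth P α
    have hlt' : pre.length < (expand θ P α).length := by
      rw [e, hblock]
      simp only [List.length_append]
      omega
    rw [hb, ← hpos] at h2
    obtain ⟨i', hi', hs2⟩ := useJump_ajmp (tau := tau) (f := irf)
      (H := irfService θ meth none) h2 (by omega) (some τ)
    exact ⟨pre, i', .tail (.single hs1) hs2, ⟨post, by rw [e, hblock]⟩, hi', hlen⟩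
  | succ d ih =>
    intro j hj i hi
    have hj' : θ τ ≠ j := by
      intro h
      rw [h] at hj
      omega
    have hK := (θ τ).isLt
    obtain ⟨t, ht, h1, h2⟩ := pgap2pgld_getElem?_search θ act irf meth P α hr hr' j
    obtain rfl : synthPos θ act irf meth P α i = t := by omega
    have hs1 : Silent (synthStep tau θ act irf meth P α) {tau} (i, some τ) (i + 2, some τ) := by
      refine ⟨tau, rfl, ?_⟩
      unfold synthStep
      refine (useJump_pos (tau := tau) (f := irf) (H := irfService θ meth none) h1
        (some τ)).trans ?_
      refine (useView_eqr hmeth tau irf j _ none τ).trans ?_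
      simp [hj']
      rfl
    have hlt : synthPos θ act irf meth P α i + 1 < (pgap2pgld θ act irf meth P α).length :=
      (List.getElem?_eq_some_iff.1 h2).1
    have hpos : synthPos θ act irf meth P α (i + 2) = synthPos θ act irf meth P α i + 2 :=
      add_mod_of_lt (Nat.succ_lt_succ (Nat.lt_succ_of_lt hlt))
    obtain ⟨pre, i', hreach, hb⟩ := ih ⟨j + 1, by omega⟩ (by dsimp only; omega) (i + 2)
      (by dsimp only; omega)
    exact ⟨pre, i', .head hs1 hreach, hb⟩

end Simulation

/-! ### The weak bisimulation -/

section Main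

open Relation

variable {A F M I : Type} {n : ℕ} {Instr : Finset (CPInstr A)} {K : ℕ}
  {tau gnl : I} {θ : IRFS n Instr ≃ Fin K} {act : A → F × M} {irf : F} {meth : IRFMeth A → M}
  {N : NotIndex → ProgLang A} {P : PGAp A} {α : PVector N}

/-- Registers hold core instructions only, so filling get instructions introduces no put
instructions. -/
theorem PutsIn.fill {x : PGAp A} (h : PutsIn n Instr x) (σ : IRFState A) :
    PutsIn n Instr (x.fill σ) := by
  rintro i u ⟨j, hj⟩
  refine h i u ⟨j, ?_⟩
  unfold Term.fill at hj
  rw [Term.at_map, Option.map_eq_some_iff] at hj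
  obtain ⟨v, hv, e⟩ := hj
  rw [hv]
  revert e
  unfold PInstr.fill
  split
  · split
    · next w _ => cases w <;> simp [PInstr.core]
    · simp
  · rintro rfl
    rfl

theorem PVector.exists_mem_of_prj? {i : ℕ} {p : PGAp A} (h : α.prj? i = some p) :
    (1 ≤ i ∧ i ≤ α.length) ∧ ∃ e ∈ α, (N e.1).prj e.2 = p := by
  unfold PVector.prj? at h
  split at h
  · cases h
  · rw [Option.map_eq_some_iff] at h
    obtain ⟨e, he, hp⟩ := h
    have := (List.getElem?_eq_some_iff.1 he).1
    exact ⟨by omega, e, List.mem_of_getElem? he, hp⟩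

theorem PVector.prj?_eq_none {i : ℕ} (h : α.prj? i = none) : ¬ (1 ≤ i ∧ i ≤ α.length) := by
  unfold PVector.prj? at h
  split at h
  · omega
  · rw [Option.map_eq_none_iff, List.getElem?_eq_none_iff] at h
    omega

/-- Congruence modulo 0 is equality, so a program without repetition has no positions to identify.
-/
theorem samePos_zero {p i j : ℕ} (h : SamePos p 0 i j) : i = j := by
  rcases h with h | ⟨-, -, h⟩
  · exact h
  · simpa [Nat.ModEq] using h

theorem Located.mk_of {x : PGAp A} {pre : List (CInstr (A ⊕ SBInstr A) A)} {i i' j : ℕ}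
    {τ : IRFS n Instr} (hb : AtBlock θ act irf meth P α x pre i j)
    (hs : SamePos x.canon.1.length x.canon.2.length i' j) (hp : PutsIn n Instr x) :
    Located θ act irf meth P α (i, some τ) ⟨x, i', τ.1⟩ :=
  ⟨pre, j, τ, rfl, rfl, hb, hs, hp⟩

/-- One instruction of a program is simulated by the synthesized program. -/
theorem simulation_step (hact : ∀ a, (act a).1 ≠ irf)
    (hmeth : Set.InjOn meth (methIRF n Instr K)) (hα : ∀ e ∈ α, PutsIn n Instr ((N e.1).prj e.2))
    {x : PGAp A} {pre : List (CInstr (A ⊕ SBInstr A) A)} {i i' j : ℕ}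
    {τ : IRFS n Instr} (hb : AtBlock θ act irf meth P α x pre i j)
    (hs : SamePos x.canon.1.length x.canon.2.length i' j) (hp : PutsIn n Instr x)
    (hj : j < x.canon.1.length + x.canon.2.length) :
    (∃ c', Silent (polyJump tau gnl act α) ({gnl} ∪ {tau}) ⟨x, i', τ.1⟩ c' ∧
      ∃ p', TransGen (Silent (synthStep tau θ act irf meth P α) {tau}) (i, some τ) p' ∧
        Located θ act irf meth P α p' c') ∨
    ((synthStep tau θ act irf meth P α (i, some τ)).Visible {tau} ∧
      (polyJump tau gnl act α ⟨x, i', τ.1⟩).Visible ({gnl} ∪ {tau}) ∧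
      View.Rel (Located θ act irf meth P α) (synthStep tau θ act irf meth P α (i, some τ))
        (polyJump tau gnl act α ⟨x, i', τ.1⟩)) ∨
    (hide (synthStep tau θ act irf meth P α) {tau} (i, some τ) = .dead ∧
      hide (polyJump tau gnl act α) ({gnl} ∪ {tau}) ⟨x, i', τ.1⟩ = .dead) := by
  have hS : tau ∈ ({gnl} ∪ {tau} : Set I) := .inr rfl
  obtain ⟨u, hu⟩ : ∃ u, (x.canon.1 ++ x.canon.2)[j]? = some u :=
    ⟨_, List.getElem?_eq_getElem (by simpa using hj)⟩
  have hat : x.at i' = some u := (Term.at_of_samePos hs hj).trans hu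
  have hcu := pga2pglc_getElem? x hj
  rw [hu, Option.map_some] at hcu
  have hD := hb.getElem?_eq hcu
  have hlen := length_pga2pglc x
  -- No instruction other than a jump or a switch-over advances by more than 2, and the two closing
  -- instructions keep that target inside the block.
  have next (d : ℕ) (hd : d ≤ 2) (τ : IRFS n Instr) :
      Located θ act irf meth P α (i + d, some τ) ⟨x, i' + d, τ.1⟩ :=
    .mk_of (hb.add (by omega)) (hs.add d) hp
  rcases u with (a | r | ⟨r, u⟩ | r) | a | a | l | _
  · have h1 : synthStep tau θ act irf meth P α (i, some τ) =
        .act (act a) (fun _ => (i + 1, some τ)) :=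
      (useJump_plain (H := irfService θ meth none) hD (some τ)).trans
        (useView_act_of_ne (hact a) _ _)
    have h2 : polyJump tau gnl act α ⟨x, i', τ.1⟩ = .act (act a) (fun _ => ⟨x, i' + 1, τ.1⟩) := by
      simp only [polyJump, hat]
    rw [h1, h2]
    exact .inr (.inl ⟨by rintro _ _ _ ⟨⟩, by rintro _ _ _ ⟨⟩, .act _ _ _ fun _ =>
      next 1 (by omega) τ⟩)
  · simp only [PInstr.toPGLC, CInstr.toPGLD, DInstr.translate] at hD
    cases hprj : α.prj? r with
    | none =>
      rw [if_neg (PVector.prj?_eq_none hprj)] at hD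
      have h1 : synthStep tau θ act irf meth P α (i, some τ) = .exit :=
        useJump_halt (H := irfService θ meth none) hD (some τ)
      have h2 : polyJump tau gnl act α ⟨x, i', τ.1⟩ = .exit := by
        simp only [polyJump, hat, hprj]
      rw [h1, h2]
      exact .inr (.inl ⟨by rintro _ _ _ ⟨⟩, by rintro _ _ _ ⟨⟩, .exit⟩)
    | some p =>
      obtain ⟨hr, e, he, hpe⟩ := PVector.exists_mem_of_prj? hprj
      rw [if_pos hr] at hD
      -- The current state has a number, so the list of tests is nonempty and its first test is the
      -- target of the jump.
      have hK : 0 < K := Nat.lt_of_le_of_lt (Nat.zero_le _) (θ τ).isLt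
      obtain ⟨t, ht, h1, -⟩ :=
        pgap2pgld_getElem?_search θ act irf meth P α hr.1 hr.2 ⟨0, hK⟩
      have ht' : searchPos θ P α r = t + 1 := by
        rw [ht]; simp
      rw [ht'] at hD
      obtain ⟨k, hk, hsil⟩ := useJump_ajmp (tau := tau) (f := irf) (H := irfService θ meth none)
        hD (List.getElem?_eq_some_iff.1 h1).1 (some τ)
      obtain ⟨pre', k', hreach, hb'⟩ := exists_reach_block (tau := tau) (θ := θ) (P := P) (act := act)
        (irf := irf) hmeth hr.1 hr.2 τ (θ τ) ⟨0, hK⟩ (by simp) k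
        (by rw [ht']; unfold synthPos; rw [hk]; simp)
      have htrans : TransGen (Silent (synthStep tau θ act irf meth P α) {tau})
          (i, some τ) (k', some τ) := TransGen.head' hsil hreach
      by_cases hget : NoGet (p.fill τ.1)
      · have hgen : generate α r τ.1 = p.fill τ.1 := by
          simp only [generate, hprj, if_pos hget]
        rw [hgen] at hb'
        refine .inl ⟨⟨p.fill τ.1, 0, τ.1⟩, ⟨gnl, .inl rfl, ?_⟩, _, htrans,
          .mk_of hb' (.inl rfl) (.fill (hpe ▸ hα e he) _)⟩
        simp only [polyJump, hat, hprj, if_pos hget]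
      · have hgen : generate α r τ.1 = .instr (.jmp 0) := by
          simp only [generate, hprj, if_neg hget]
        rw [hgen] at hb'
        -- The instance that is reached consists of a jump to itself, so both executions diverge.
        refine .inr (.inr ⟨?_, hide_eq_dead_of_loop ⟨tau, hS, ?_⟩⟩)
        · rw [hide_of_reach htrans.to_reflTransGen]
          exact hb'.loop_fjmp rfl _
        · simp only [polyJump, hat, hprj, if_neg hget]
  · obtain ⟨hr, hu'⟩ := hp r u ⟨i', hat⟩
    refine .inl ⟨⟨x, i' + 1, τ.1.put r u⟩, ⟨tau, hS, ?_⟩, _, .single ⟨tau, rfl, ?_⟩,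
      next 1 (by omega) ⟨τ.1.put r u, IRFS.put_mem τ.2 hr hu'⟩⟩
    · simp only [polyJump, hat]
    · exact (useJump_plain (H := irfService θ meth none) hD (some τ)).trans
        (useView_put hmeth tau irf hr hu' _ none τ)
  · refine .inr (.inr ⟨hb.loop hcu rfl _, hide_eq_dead_of_loop ⟨tau, hS, ?_⟩⟩)
    simp only [polyJump, hat]
  · have h1 : synthStep tau θ act irf meth P α (i, some τ) =
        .act (act a) (fun r => (if r then i + 1 else i + 2, some τ)) :=
      (useJump_pos (H := irfService θ meth none) hD (some τ)).trans
        (useView_act_of_ne (hact a) _ _)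
    have h2 : polyJump tau gnl act α ⟨x, i', τ.1⟩ =
        .act (act a) (fun r => ⟨x, if r then i' + 1 else i' + 2, τ.1⟩) := by
      simp only [polyJump, hat]
    rw [h1, h2]
    refine .inr (.inl ⟨by rintro _ _ _ ⟨⟩, by rintro _ _ _ ⟨⟩, .act _ _ _ fun r => ?_⟩)
    cases r
    · exact next 2 (by omega) τ
    · exact next 1 (by omega) τ
  · have h1 : synthStep tau θ act irf meth P α (i, some τ) =
        .act (act a) (fun r => (if r then i + 2 else i + 1, some τ)) :=
      (useJump_neg (H := irfService θ meth none) hD (some τ)).trans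
        (useView_act_of_ne (hact a) _ _)
    have h2 : polyJump tau gnl act α ⟨x, i', τ.1⟩ =
        .act (act a) (fun r => ⟨x, if r then i' + 2 else i' + 1, τ.1⟩) := by
      simp only [polyJump, hat]
    rw [h1, h2]
    refine .inr (.inl ⟨by rintro _ _ _ ⟨⟩, by rintro _ _ _ ⟨⟩, .act _ _ _ fun r => ?_⟩)
    cases r
    · exact next 1 (by omega) τ
    · exact next 2 (by omega) τ
  · have h2 : Silent (polyJump tau gnl act α) ({gnl} ∪ {tau}) ⟨x, i', τ.1⟩
        ⟨x, i' + l, τ.1⟩ := ⟨tau, hS, by simp only [polyJump, hat]⟩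
    by_cases hl : j + 1 + l ≤ x.canon.1.length + x.canon.2.length
    · simp only [PInstr.toPGLC, if_pos hl] at hcu
      have hlt := hb.lt_expand (k := j + l) (by omega)
      obtain ⟨k, hk, hsil⟩ := hb.jump (tau := tau) (k := j + l) hcu
        (by simp only [CInstr.toPGLD]; rw [if_pos (by omega)]; congr 1; omega) (by omega) (some τ)
      exact .inl ⟨_, h2, _, .single hsil, .mk_of hk (hs.add l) hp⟩
    · by_cases hq : x.canon.2.length = 0
      · simp only [PInstr.toPGLC, if_neg hl, if_pos hq] at hcu
        refine .inr (.inr ⟨hb.loop_fjmp hcu _, ?_⟩)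
        -- Without repetition the positions on both sides agree exactly, so the jump leaves the
        -- sequence, where the slowed-down execution loops.
        rw [hq] at hs
        have := samePos_zero hs
        rw [hide_of_silent h2]
        refine hide_eq_dead_of_loop ⟨tau, hS, ?_⟩
        have hnone := Term.at_eq_none (x := x) (i := i' + l) (List.length_eq_zero_iff.1 hq)
          (by omega)
        simp only [polyJump, hnone]
      · simp only [PInstr.toPGLC, if_neg hl, if_neg hq] at hcu
        rw [show j + 1 + l - (x.canon.1.length + 1) = j + l - x.canon.1.length by omega,
          show x.canon.1.length + 1 + (j + l - x.canon.1.length) % x.canon.2.length =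
            x.canon.1.length + (j + l - x.canon.1.length) % x.canon.2.length + 1 by omega] at hcu
        have hmod := Nat.mod_lt (j + l - x.canon.1.length) (Nat.pos_of_ne_zero hq)
        have hlt := hb.lt_expand
          (k := x.canon.1.length + (j + l - x.canon.1.length) % x.canon.2.length) (by omega)
        obtain ⟨k, hk, hsil⟩ := hb.jump (tau := tau) hcu (toPGLD_goto hlt) (by omega) (some τ)
        -- The embedding folds the target back into the first copy of the repeated part, which
        -- preserves the position up to unfolding.
        exact .inl ⟨_, h2, _, .single hsil,
          .mk_of hk ((hs.add l).trans (.fold _ _ _ (by omega))) hp⟩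
  · have h1 : synthStep tau θ act irf meth P α (i, some τ) = .exit :=
      useJump_halt (H := irfService θ meth none) hD (some τ)
    have h2 : polyJump tau gnl act α ⟨x, i', τ.1⟩ = .exit := by
      simp only [polyJump, hat]
    rw [h1, h2]
    exact .inr (.inl ⟨by rintro _ _ _ ⟨⟩, by rintro _ _ _ ⟨⟩, .exit⟩)

/-- Before an instruction is compared, the synthesized program may first have to follow closing
jumps back into the repeated part. These extra silent steps are absorbed by `hide_rel`. -/
theorem hide_rel_of_located (hact : ∀ a, (act a).1 ≠ irf)
    (hmeth : Set.InjOn meth (methIRF n Instr K)) (hα : ∀ e ∈ α, PutsIn n Instr ((N e.1).prj e.2))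
    {p : ℕ × Option (IRFS n Instr)} {c : Config A} (h : Located θ act irf meth P α p c) :
    View.Rel (Located θ act irf meth P α) (hide (synthStep tau θ act irf meth P α) {tau} p)
      (hide (polyJump tau gnl act α) ({gnl} ∪ {tau}) c) := by
  refine hide_rel (Located θ act irf meth P α) ?_ h
  rintro ⟨i, _⟩ ⟨x, i', _⟩ ⟨pre, j, τ, rfl, rfl, hb, hs, hp⟩
  dsimp only at hb hs hp
  -- The remaining possibility is a finite program whose end has been passed: one side is at a
  -- closing jump to itself, the other outside the sequence.
  by_cases hout : x.canon.2 = [] ∧ x.canon.1.length ≤ j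
  · obtain ⟨hq, hj⟩ := hout
    have hq' : x.canon.2.length = 0 := by rw [hq]; rfl
    have hlt := hb.lt
    rw [length_pga2pglc] at hlt
    have hu := pga2pglc_getElem?_of_le x (by omega) hlt
    rw [if_pos hq] at hu
    rw [hq'] at hs
    have hnone := Term.at_eq_none (x := x) (i := i') hq (by rwa [samePos_zero hs])
    refine .inr (.inr ⟨hb.loop_fjmp hu _, hide_eq_dead_of_loop ⟨tau, .inr rfl, ?_⟩⟩)
    simp only [polyJump, hnone]
  · obtain ⟨k, j', hreach, hb', hj', hs'⟩ : ∃ k j',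
        ReflTransGen (Silent (synthStep tau θ act irf meth P α) {tau})
          (i, some τ) (k, some τ) ∧ AtBlock θ act irf meth P α x pre k j' ∧
        j' < x.canon.1.length + x.canon.2.length ∧
        SamePos x.canon.1.length x.canon.2.length j j' := by
      by_cases hq : x.canon.2 = []
      · exact ⟨i, j, .refl, hb, by
          have : ¬ x.canon.1.length ≤ j := fun h => hout ⟨hq, h⟩
          omega, .inl rfl⟩
      · exact hb.fold hq _
    rcases simulation_step (tau := tau) (gnl := gnl) hact hmeth hα (τ := τ) hb' (hs.trans hs') hp
      hj' with ⟨c', hc', p', hp', hR⟩ | ⟨hv, hv', hR⟩ | ⟨hd, hd'⟩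
    · exact .inl ⟨c', hc', p', TransGen.trans_right hreach hp', hR⟩
    · exact .inr (.inl ⟨_, hreach, hv, hv', hR⟩)
    · exact .inr (.inr ⟨by rw [hide_of_reach hreach, hd], hd'⟩)

theorem located_start (σ : IRFS n Instr) (hP : PutsIn n Instr P) :
    Located θ act irf meth P α (0, some σ) ⟨P, 0, σ.1⟩ := by
  refine .mk_of (pre := []) (j := 0) ⟨⟨_, rfl⟩, ?_, ?_⟩ (.inl rfl) hP
  · simp [synthPos]
  · rw [length_pga2pglc]
    omega

end Main

end PolyInSeq

open PolyInSeq
theorem theorem1 {F M I : Type} (tau gnl : I) (hgnl : tau ≠ gnl) (irf : F)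
    (CB : Set (F × M)) (hCB : ∀ a ∈ CB, a.1 ≠ irf)
    (N : NotIndex → ProgLang CB) (P : PGAp CB) (α : PVector N)
    (n : ℕ) (Instr : Finset (CPInstr CB))
    (hput : ∀ i u, OccursIn (iPut i u) P α → (1 ≤ i ∧ i ≤ n) ∧ u ∈ Instr)
    (K : ℕ) (θ : IRFS n Instr ≃ Fin K)
    (meth : IRFMeth CB → M) (hmeth : Set.InjOn meth (methIRF n Instr K))
    (σ : IRFS n Instr) :
    abstr tau (use tau (extr I (pgld2pga (pgap2pgld θ Subtype.val irf meth P α))) irf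
        (irfService θ meth (some σ))) =
      abstr tau (abstr gnl (extrp tau gnl Subtype.val σ.1 α P)) := by
  rw [abstr_use_extr, abstr_extrp]
  -- The system is named explicitly because it equals the one with initial service state `some σ`
  -- only by unfolding definitions; that state enters through the starting pair.
  exact Thread.unfold_eq_unfold (f := hide (synthStep tau θ Subtype.val irf meth P α) {tau})
    (Located θ Subtype.val irf meth P α)
    (fun p c h => hide_rel_of_located (tau := tau) (gnl := gnl) (θ := θ) (act := Subtype.val)
      (P := P) (fun a => hCB a.1 a.2) hmeth
      (fun e he i u h => hput i u (.inr ⟨e, he, h⟩)) h)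
    (located_start σ fun i u h => hput i u (.inl h))
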